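/- **Setting.** Up to $GL(2,\mathbb Z)$ there are 16 reflexive polygons $\Delta_1,\dots,\Delta_{16}$ in the plane (lattice polygons whose dual $\Delta^\circ=\{u : u\cdot v\ge -1\ \forall v\in\Delta\}$ is again a lattice polygon), represented by the following sets of vertices: 1. $(2,-1),(-1,2),(-1,-1)$ 2. $(-1,2),(-1,-2),(1,0)$ 3. $(1,0),(1,-1),(-1,2),(-1,-1)$ 4. $(1,1),(1,-1),(-1,1),(-1,-1)$ 5. $(1,0),(-1,2),(-1,-1),(0,-1)$ 6. $(1,1),(0,1),(1,-1),(-1,0),(-1,-1)$ 7. $(1,0),(-1,-2),(-1,1)$ 8. $(1,1),(-1,1),(0,-1),(-1,-1)$ 9. $(-1,1),(-1,-1),(1,0),(0,1),(0,-1)$ 10. $(-1,0),(1,0),(1,1),(0,-1),(0,1),(-1,-1)$ 11. $(1,-1),(-1,-1),(-1,0),(0,1)$ 12. $(1,0),(-1,0),(0,-1),(0,1),(-1,-1)$ 13. $(-1,1),(-1,-1),(1,0)$ 14. $(0,1),(0,-1),(1,-1),(-1,0)$ 15. $(1,0),(-1,0),(0,1),(0,-1)$ 16. $(1,1),(-1,0),(0,-1)$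 For $\Delta=\Delta_a$ let $\sigma\subset\mathbb R^3$ be the cone spanned by the vectors $(v,1)$, $v$ a vertex of $\Delta$, let $S_a=\sigma^\vee\cap\mathbb Z^3$, and let $\mathcal X_a=\operatorname{Spec}\mathbb C[S_a]$ be the associated toric Calabi–Yau 3-fold ("Model $a$"). Its generators $x_1,\dots,x_k$ are the monomials of the minimal generating set of $S_a$; write $\mathbb C[S_a]=\mathbb C[x_1,\dots,x_k]/I$. If the $x_i$ are given real degrees $q_i>0$ for which an ideal $J$ is homogeneous, the Hilbert series of $\mathbb C[x]/J$ is $g(t)=\sum_r\dim(\mathbb C[x]/J)_r\,t^r$, and $A_0,A_1$ are defined by $g(e^{-s})=2A_0s^{-3}+A_1s^{-2}+O(s^{-1})$ as $s\to0^+$. *Volume minimization.* Let $b=(b_v)_v$, with $v$ running over the vertices, satisfy $b_v>0$ and $\sum_v b_v=2$; it gives the generator $x_h$, with exponent $m_h\in S_a$, the degree $\sum_v b_v\langle m_h,(v,1)\rangle$. The normalized volume function of the Sasaki–Einstein base $Y_a$ is $V(b;Y_a)=\frac{8}{27}\lim_{s\to0^+}s^3g(e^{-s})$, with $g$ the Hilbert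 series of $\mathcal X_a$ in this grading. Let $V_{\min}(Y_a)=\min_bV(b;Y_a)=V(b^*;Y_a)$. The $U(1)_R$ symmetry $\zeta_R$ is the grading defined by a minimizer $b^*$, and $R_h=\sum_v b^*_v\langle m_h,(v,1)\rangle$ is the $R$-charge of $x_h$. *Futaki invariant.* The test symmetry $\eta_h$ acts by $x_h\mapsto\lambda x_h$ and fixes the other generators. It defines a test configuration whose central fibre is $\mathbb C[x]/I_0$, with $I_0$ generated by the lowest $\eta_h$-weight parts of the elements of $I$. Let $A_i(\zeta_R)$ be the coefficients for $\mathcal X_a$ graded by $\zeta_R$, and $A_i(\zeta_R+\epsilon\eta_h)$ those for the central fibre graded by $\zeta_R+\epsilon\eta_h$. With $n=3$, $$F(\mathcal X_a;\zeta_R,\eta_h)=\left[\frac{A_0(\zeta_R)}{n-1}\,\frac{d}{d\epsilon}\frac{A_1(\zeta_R+\epsilon\eta_h)}{A_0(\zeta_R+\epsilon\eta_h)}+\frac{A_1(\zeta_R)}{n(n-1)A_0(\zeta_R)}\,\frac{d}{d\epsilon}A_0(\zeta_R+\epsilon\eta_h)\right]_{\epsilon=0}.$$ **Proposition.** For every $a\in\{1,\dots,16\}$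 the minimum $V_{\min}(Y_a)$ is attained, and for every minimizer $b^*$ and every generator $x_h$ of $\mathcal X_a$ the Futaki invariant $F(\mathcal X_a;\zeta_R,\eta_h)$ is well defined and $$F(\mathcal X_a;\zeta_R,\eta_h)\ \ge\ \tfrac{27}{64}\,V_{\min}(Y_a).$$ Equality holds if and only if $R_h=\tfrac43$, and a generator with $R_h=\tfrac43$ exists precisely in Models $a=2$, $7$ and $13$. -/

import Mathlib

open Filter Topology Asymptotics

namespace FutakiReflexive

/-! ### Lattice polygons in the plane and reflexivity -/

/-- The inclusion of the lattice `ℤ²` into the plane `ℝ²`. -/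
def toPlane (v : ℤ × ℤ) : ℝ × ℝ := ((v.1 : ℝ), (v.2 : ℝ))

/-- The polygon spanned by a finite set of lattice points. -/
def hull (V : Finset (ℤ × ℤ)) : Set (ℝ × ℝ) := convexHull ℝ (toPlane '' (V : Set (ℤ × ℤ)))

/-- A lattice polytope is the convex hull of finitely many lattice points. -/
def IsLatticePolytope (P : Set (ℝ × ℝ)) : Prop := ∃ W : Finset (ℤ × ℤ), P = hull W

/-- The dual polytope `Δ° = {u | u ⬝ v ≥ -1 for all v ∈ Δ}`. -/
def polar (P : Set (ℝ × ℝ)) : Set (ℝ × ℝ) := {u | ∀ v ∈ P, -1 ≤ u.1 * v.1 + u.2 * v.2}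

/-- A reflexive polygon, given by its set of extremal points: the dual of the polygon is again a
lattice polytope.  (In particular the dual is bounded, so the origin is an interior point.) -/
structure ReflexivePolygon where
  /-- the extremal points of the polygon -/
  vertices : Finset (ℤ × ℤ)
  extremal : ∀ v ∈ vertices, toPlane v ∉ hull (vertices.erase v)
  reflexive : IsLatticePolytope (polar (hull vertices))

/-- The dot product on `ℤ²`. -/
def dot (u v : ℤ × ℤ) : ℤ := u.1 * v.1 + u.2 * v.2

theorem extremal_of_functional {V : Finset (ℤ × ℤ)} {v c : ℤ × ℤ}
    (h : ∀ w ∈ V.erase v, dot c v < dot c w) : toPlane v ∉ hull (V.erase v) := by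
  intro hv
  have hconv : Convex ℝ {x : ℝ × ℝ | (dot c v : ℝ) < (c.1 : ℝ) * x.1 + (c.2 : ℝ) * x.2} := by
    intro x hx y hy a b ha hb hab
    simp only [Set.mem_ofPred_eq, Prod.fst_add, Prod.snd_add, Prod.smul_fst, Prod.smul_snd,
      smul_eq_mul] at *
    obtain rfl : b = 1 - a := by linarith
    rcases eq_or_lt_of_le ha with h0 | h0
    · subst h0; linarith
    · nlinarith [mul_pos h0 (sub_pos.2 hx), mul_nonneg hb (sub_pos.2 hy).le]
  have hsub : hull (V.erase v) ⊆
      {x : ℝ × ℝ | (dot c v : ℝ) < (c.1 : ℝ) * x.1 + (c.2 : ℝ) * x.2} := by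
    refine convexHull_min ?_ hconv
    rintro _ ⟨w, hw, rfl⟩
    have := h w (by simpa [and_comm] using hw)
    simp only [Set.mem_ofPred_eq, toPlane]
    have h2 : (dot c v : ℝ) < (dot c w : ℝ) := by exact_mod_cast this
    simpa [dot] using h2
  have := hsub hv
  simp [toPlane, dot] at this

theorem support_aux {p q x y x₁ y₁ x₂ y₂ a b c d s t : ℝ}
    (e1 : x * a + y * b = -1) (e2 : x * c + y * d = -1) (e3 : x₁ * a + y₁ * b = -1)
    (e4 : -1 < x₁ * c + y₁ * d) (e5 : x₂ * c + y₂ * d = -1) (e6 : -1 < x₂ * a + y₂ * b)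
    (m1 : p * x + q * y ≤ p * x₁ + q * y₁) (m2 : p * x + q * y ≤ p * x₂ + q * y₂)
    (u1 : -1 ≤ s * a + t * b) (u2 : -1 ≤ s * c + t * d) :
    p * x + q * y ≤ p * s + q * t := by
  have k1 : 0 < (x₁ - x) * c + (y₁ - y) * d := by linarith
  have k2 : 0 < (x₂ - x) * a + (y₂ - y) * b := by linarith
  set A := (p * (x₂ - x) + q * (y₂ - y)) / ((x₂ - x) * a + (y₂ - y) * b) with hA
  set B := (p * (x₁ - x) + q * (y₁ - y)) / ((x₁ - x) * c + (y₁ - y) * d) with hB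
  have hA0 : 0 ≤ A := div_nonneg (by linarith) k2.le
  have hB0 : 0 ≤ B := div_nonneg (by linarith) k1.le
  have f1 : (x₁ - x) * a + (y₁ - y) * b = 0 := by linarith
  have f2 : (x₂ - x) * c + (y₂ - y) * d = 0 := by linarith
  have hA1 : A * ((x₂ - x) * a + (y₂ - y) * b) = p * (x₂ - x) + q * (y₂ - y) :=
    div_mul_cancel₀ _ k2.ne'
  have hB1 : B * ((x₁ - x) * c + (y₁ - y) * d) = p * (x₁ - x) + q * (y₁ - y) :=
    div_mul_cancel₀ _ k1.ne'
  have g1 : (p - A * a - B * c) * (x₁ - x) + (q - A * b - B * d) * (y₁ - y) = 0 := by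
    linear_combination -A * f1 - hB1
  have g2 : (p - A * a - B * c) * (x₂ - x) + (q - A * b - B * d) * (y₂ - y) = 0 := by
    linear_combination -B * f2 - hA1
  have hdet : (x₁ - x) * (y₂ - y) - (x₂ - x) * (y₁ - y) ≠ 0 := by
    intro h0
    have : ((x₁ - x) * c + (y₁ - y) * d) * ((x₂ - x) * a + (y₂ - y) * b) = 0 := by
      linear_combination ((x₂ - x) * c + (y₂ - y) * d) * f1 + (b * c - a * d) * h0
    exact (mul_pos k1 k2).ne' this
  have h1 : p = A * a + B * c := by
    have : (p - A * a - B * c) * ((x₁ - x) * (y₂ - y) - (x₂ - x) * (y₁ - y)) = 0 := by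
      linear_combination (y₂ - y) * g1 - (y₁ - y) * g2
    linarith [(mul_eq_zero.1 this).resolve_right hdet]
  have h2 : q = A * b + B * d := by
    have : (q - A * b - B * d) * ((x₁ - x) * (y₂ - y) - (x₂ - x) * (y₁ - y)) = 0 := by
      linear_combination (x₁ - x) * g2 - (x₂ - x) * g1
    linarith [(mul_eq_zero.1 this).resolve_right hdet]
  have h3 : p * s + q * t - (p * x + q * y)
      = A * (s * a + t * b + 1) + B * (s * c + t * d + 1) := by
    rw [h1, h2]; linear_combination -A * e1 - B * e2
  have := mul_nonneg hA0 (by linarith : 0 ≤ s * a + t * b + 1)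
  have := mul_nonneg hB0 (by linarith : 0 ≤ s * c + t * d + 1)
  linarith

theorem isLatticePolytope_polar {V W : Finset (ℤ × ℤ)} (hW : W.Nonempty)
    (h1 : ∀ w ∈ W, ∀ v ∈ V, -1 ≤ dot w v)
    (h2 : ∀ w ∈ W, ∃ v₁ ∈ V, ∃ v₂ ∈ V, dot w v₁ = -1 ∧ dot w v₂ = -1 ∧
      (∃ w₁ ∈ W, dot w₁ v₁ = -1 ∧ -1 < dot w₁ v₂) ∧
      (∃ w₂ ∈ W, dot w₂ v₂ = -1 ∧ -1 < dot w₂ v₁)) :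
    IsLatticePolytope (polar (hull V)) := by
  refine ⟨W, Set.Subset.antisymm ?_ ?_⟩
  · intro u hu
    by_contra hn
    have hcl : IsClosed (hull W) := (W.finite_toSet.image _).isClosed_convexHull ℝ
    obtain ⟨f, s, hfu, hfs⟩ := geometric_hahn_banach_point_closed (convex_convexHull ℝ _) hcl hn
    have hf : ∀ x : ℝ × ℝ, f x = f (1, 0) * x.1 + f (0, 1) * x.2 := by
      intro x
      have : x = x.1 • ((1, 0) : ℝ × ℝ) + x.2 • ((0, 1) : ℝ × ℝ) := by ext <;> simp
      conv_lhs => rw [this]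
      simp only [map_add, map_smul, smul_eq_mul]
      ring
    obtain ⟨w, hw, hmin⟩ := W.exists_min_image (fun w => f (toPlane w)) hW
    obtain ⟨v₁, hv₁, v₂, hv₂, e1, e2, ⟨w₁, hw₁, e3, e4⟩, ⟨w₂, hw₂, e5, e6⟩⟩ := h2 w hw
    have hlt : f u < f (toPlane w) :=
      hfu.trans (hfs _ (subset_convexHull ℝ _ ⟨w, by simpa using hw, rfl⟩))
    have m1 := hmin w₁ hw₁
    have m2 := hmin w₂ hw₂
    have u1 := hu (toPlane v₁) (subset_convexHull ℝ _ ⟨v₁, by simpa using hv₁, rfl⟩)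
    have u2 := hu (toPlane v₂) (subset_convexHull ℝ _ ⟨v₂, by simpa using hv₂, rfl⟩)
    rw [hf u, hf (toPlane w)] at hlt
    rw [hf (toPlane w), hf (toPlane w₁)] at m1
    rw [hf (toPlane w), hf (toPlane w₂)] at m2
    simp only [toPlane, dot] at m1 m2 hlt u1 u2 e1 e2 e3 e4 e5 e6
    have e1' : (w.1 : ℝ) * v₁.1 + w.2 * v₁.2 = -1 := by exact_mod_cast e1
    have e2' : (w.1 : ℝ) * v₂.1 + w.2 * v₂.2 = -1 := by exact_mod_cast e2
    have e3' : (w₁.1 : ℝ) * v₁.1 + w₁.2 * v₁.2 = -1 := by exact_mod_cast e3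
    have e4' : (-1 : ℝ) < w₁.1 * v₂.1 + w₁.2 * v₂.2 := by exact_mod_cast e4
    have e5' : (w₂.1 : ℝ) * v₂.1 + w₂.2 * v₂.2 = -1 := by exact_mod_cast e5
    have e6' : (-1 : ℝ) < w₂.1 * v₁.1 + w₂.2 * v₁.2 := by exact_mod_cast e6
    exact absurd (support_aux e1' e2' e3' e4' e5' e6' m1 m2 u1 u2) (not_le.2 hlt)
  · refine convexHull_min ?_ ?_
    · rintro _ ⟨w, hw, rfl⟩
      have hconv : Convex ℝ {x : ℝ × ℝ | -1 ≤ (w.1 : ℝ) * x.1 + (w.2 : ℝ) * x.2} := by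
        intro x hx y hy a b ha hb hab
        simp only [Set.mem_ofPred_eq, Prod.fst_add, Prod.snd_add, Prod.smul_fst, Prod.smul_snd,
          smul_eq_mul] at *
        nlinarith
      have : hull V ⊆ {x : ℝ × ℝ | -1 ≤ (w.1 : ℝ) * x.1 + (w.2 : ℝ) * x.2} := by
        refine convexHull_min ?_ hconv
        rintro _ ⟨v, hv, rfl⟩
        have := h1 w (by simpa using hw) v (by simpa using hv)
        simp only [dot] at this
        simp only [Set.mem_ofPred_eq, toPlane]
        exact_mod_cast this
      exact fun v hv => this hv
    · intro x hx y hy a b ha hb hab v hv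
      have := hx v hv
      have := hy v hv
      simp only [Prod.fst_add, Prod.snd_add, Prod.smul_fst, Prod.smul_snd, smul_eq_mul]
      nlinarith

/-! ### The sixteen models -/

/-- The extremal points of the toric diagrams of Models 1, …, 16, in this order. -/
def modelVertices : Fin 16 → Finset (ℤ × ℤ) :=
  ![{(2, -1), (-1, 2), (-1, -1)},
    {(-1, 2), (-1, -2), (1, 0)},
    {(1, 0), (1, -1), (-1, 2), (-1, -1)},
    {(1, 1), (1, -1), (-1, 1), (-1, -1)},
    {(1, 0), (-1, 2), (-1, -1), (0, -1)},
    {(1, 1), (0, 1), (1, -1), (-1, 0), (-1, -1)},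
    {(1, 0), (-1, -2), (-1, 1)},
    {(1, 1), (-1, 1), (0, -1), (-1, -1)},
    {(-1, 1), (-1, -1), (1, 0), (0, 1), (0, -1)},
    {(-1, 0), (1, 0), (1, 1), (0, -1), (0, 1), (-1, -1)},
    {(1, -1), (-1, -1), (-1, 0), (0, 1)},
    {(1, 0), (-1, 0), (0, -1), (0, 1), (-1, -1)},
    {(-1, 1), (-1, -1), (1, 0)},
    {(0, 1), (0, -1), (1, -1), (-1, 0)},
    {(1, 0), (-1, 0), (0, 1), (0, -1)},
    {(1, 1), (-1, 0), (0, -1)}]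

/-- The extremal points of the dual polygons of Models 1, …, 16. -/
def modelDualVertices : Fin 16 → Finset (ℤ × ℤ) :=
  ![{(1, 0), (0, 1), (-1, -1)},
    {(1, 0), (-1, 1), (-1, -1)},
    {(1, 0), (0, 1), (-1, 0), (-1, -1)},
    {(1, 0), (0, 1), (-1, 0), (0, -1)},
    {(1, 0), (0, 1), (-1, 1), (-1, -1)},
    {(1, 0), (0, 1), (-1, 0), (0, -1), (1, -1)},
    {(1, 0), (-1, 1), (-1, -2)},
    {(1, 0), (0, 1), (-2, 1), (0, -1)},
    {(1, 0), (0, 1), (-1, 1), (-1, -1), (0, -1)},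
    {(1, 0), (0, 1), (-1, 1), (-1, 0), (0, -1), (1, -1)},
    {(1, 0), (0, 1), (-2, -1), (1, -1)},
    {(1, 0), (0, 1), (-1, 1), (-1, -1), (1, -1)},
    {(1, 0), (-1, 2), (-1, -2)},
    {(1, 1), (0, 1), (-2, -1), (1, -1)},
    {(1, 1), (-1, 1), (-1, -1), (1, -1)},
    {(1, 1), (-2, 1), (1, -2)}]

theorem model_extremal (a : Fin 16) : ∀ v ∈ modelVertices a,
    toPlane v ∉ hull ((modelVertices a).erase v) := by
  have key : ∀ a : Fin 16, ∀ v ∈ modelVertices a,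
      ∃ c ∈ (Finset.Icc (-3) 3 ×ˢ Finset.Icc (-3) 3 : Finset (ℤ × ℤ)),
        ∀ w ∈ (modelVertices a).erase v, dot c v < dot c w := by decide
  intro v hv
  obtain ⟨c, -, hc⟩ := key a v hv
  exact extremal_of_functional hc

theorem model_reflexive (a : Fin 16) :
    IsLatticePolytope (polar (hull (modelVertices a))) := by
  refine isLatticePolytope_polar (W := modelDualVertices a) ?_ ?_ ?_
  · revert a; decide
  · revert a; decide
  · revert a; decide

/-- The reflexive polygon with (zero-based) index `a`, that is, the toric diagram of
Model `a + 1`. -/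
def model (a : Fin 16) : ReflexivePolygon where
  vertices := modelVertices a
  extremal := model_extremal a
  reflexive := model_reflexive a

/-- The action of an integral `2 × 2` matrix on `ℤ²`. -/
def act (M : Matrix (Fin 2) (Fin 2) ℤ) (v : ℤ × ℤ) : ℤ × ℤ :=
  (M 0 0 * v.1 + M 0 1 * v.2, M 1 0 * v.1 + M 1 1 * v.2)

theorem act_injective {M : Matrix (Fin 2) (Fin 2) ℤ} (hM : IsUnit M.det) :
    Function.Injective (act M) := by
  intro v w h
  rw [Matrix.det_fin_two] at hM
  simp only [act, Prod.mk.injEq] at h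
  obtain ⟨h1, h2⟩ := h
  have e1 : (M 0 0 * M 1 1 - M 0 1 * M 1 0) * (v.1 - w.1) = 0 := by
    linear_combination M 1 1 * h1 - M 0 1 * h2
  have e2 : (M 0 0 * M 1 1 - M 0 1 * M 1 0) * (v.2 - w.2) = 0 := by
    linear_combination M 0 0 * h2 - M 1 0 * h1
  ext
  · linarith [(mul_eq_zero.1 e1).resolve_left hM.ne_zero]
  · linarith [(mul_eq_zero.1 e2).resolve_left hM.ne_zero]

/-- The sixteen models are pairwise inequivalent under `GL(2, ℤ)`. -/
theorem model_inequivalent (a a' : Fin 16) (M : Matrix (Fin 2) (Fin 2) ℤ) (hM : IsUnit M.det)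
    (h : (model a).vertices.image (act M) = (model a').vertices) : a = a' := by
  have inj := act_injective hM
  have c1 : (modelVertices a).card = (modelVertices a').card := by
    rw [← Finset.card_image_of_injective (modelVertices a) inj]
    exact congrArg Finset.card h
  have c2 : ∀ f : ℤ → ℤ, (∀ x, f (-x) = f x) →
      ∑ v ∈ modelVertices a, ∑ w ∈ modelVertices a, f (v.1 * w.2 - v.2 * w.1)
        = ∑ v ∈ modelVertices a', ∑ w ∈ modelVertices a', f (v.1 * w.2 - v.2 * w.1) := by
    intro f hf
    have h' : (modelVertices a).image (act M) = modelVertices a' := h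
    rw [← h', Finset.sum_image inj.injOn]
    refine Finset.sum_congr rfl fun v _ => ?_
    rw [Finset.sum_image inj.injOn]
    refine Finset.sum_congr rfl fun w _ => ?_
    have : (act M v).1 * (act M w).2 - (act M v).2 * (act M w).1
        = M.det * (v.1 * w.2 - v.2 * w.1) := by
      rw [Matrix.det_fin_two]; simp only [act]; ring
    rw [this]
    rcases Int.isUnit_iff.1 hM with e | e <;> rw [e]
    · rw [one_mul]
    · rw [neg_one_mul, hf]
  have c3 := c2 (fun x => x ^ 2) (fun x => by ring)
  have c4 := c2 (fun x => |x|) abs_neg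
  clear c2 h
  revert a a'
  decide

/-! ### The toric Calabi–Yau threefold of a reflexive polygon -/

/-- The pairing of `m ∈ ℤ³` with the vector `(v, 1)`, where `v ∈ ℤ²`. -/
def pairing (m : ℤ × ℤ × ℤ) (v : ℤ × ℤ) : ℤ := m.1 * v.1 + m.2.1 * v.2 + m.2.2

/-- The lattice points `σ^∨ ∩ ℤ³` of the dual of the cone `σ` that is spanned by the vectors
`(v, 1)` with `v` an extremal point of the polygon. -/
def dualMonoid (Δ : ReflexivePolygon) : AddSubmonoid (ℤ × ℤ × ℤ) where
  carrier := {m | ∀ v ∈ Δ.vertices, 0 ≤ pairing m v}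
  zero_mem' := fun v _ => by simp [pairing]
  add_mem' := fun {x y} hx hy v hv => by
    have h1 := hx v hv
    have h2 := hy v hv
    simp only [pairing, Prod.fst_add, Prod.snd_add] at *
    linarith

/-- The coordinate ring `ℂ[σ^∨ ∩ ℤ³]` of the toric Calabi–Yau threefold `𝒳`. -/
abbrev CoordinateRing (Δ : ReflexivePolygon) : Type := AddMonoidAlgebra ℂ (dualMonoid Δ)

/-- The generators `x_h` of `𝒳`: the elements of the minimal generating set of `σ^∨ ∩ ℤ³`, that
is, the nonzero elements that are not a sum of two nonzero elements. -/
def Generator (Δ : ReflexivePolygon) : Type :=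
  {m : dualMonoid Δ // m ≠ 0 ∧ ∀ x y : dualMonoid Δ, m = x + y → x = 0 ∨ y = 0}

/-- The presentation `ℂ[x_1, …, x_k] → ℂ[σ^∨ ∩ ℤ³]` of the coordinate ring. -/
noncomputable def presentation (Δ : ReflexivePolygon) :
    MvPolynomial (Generator Δ) ℂ →ₐ[ℂ] CoordinateRing Δ :=
  MvPolynomial.aeval fun h : Generator Δ => AddMonoidAlgebra.single h.1 (1 : ℂ)

/-- The defining ideal `I = ⟨f_i⟩` of `𝒳`, so that the coordinate ring of `𝒳` is
`ℂ[x_1, …, x_k] / I`. -/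
noncomputable def toricIdeal (Δ : ReflexivePolygon) : Ideal (MvPolynomial (Generator Δ) ℂ) :=
  RingHom.ker (presentation Δ)

/-! ### Hilbert series and test configurations -/

/-- The ideal `I₀` of the central fibre of the test configuration induced by the `ℂ^*`-action
`x_i ↦ λ ^ (w i) x_i`.  It is generated by the lowest weight parts `in(f)` of all `f ∈ I`. -/
noncomputable def centralFibreIdeal {ι : Type} (I : Ideal (MvPolynomial ι ℂ)) (w : ι → ℕ) :
    Ideal (MvPolynomial ι ℂ) :=
  Ideal.span {p | ∃ f ∈ I, ∃ d : ℕ,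
    (∀ e < d, MvPolynomial.weightedHomogeneousComponent w e f = 0) ∧
      p = MvPolynomial.weightedHomogeneousComponent w d f}

/-- The graded piece of degree `r` of `ℂ[x] / I`, where `x_i` has degree `q i`. -/
noncomputable def gradedPiece {ι : Type} (I : Ideal (MvPolynomial ι ℂ)) (q : ι → ℝ) (r : ℝ) :
    Submodule ℂ (MvPolynomial ι ℂ ⧸ I) :=
  (MvPolynomial.weightedHomogeneousSubmodule ℂ q r).map (Ideal.Quotient.mkₐ ℂ I).toLinearMap

/-- The Hilbert series `∑_r dim (ℂ[x] / I)_r t ^ r` of `ℂ[x] / I`, where `x_i` has degree `q i`. -/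
noncomputable def hilbertSeries {ι : Type} (I : Ideal (MvPolynomial ι ℂ)) (q : ι → ℝ) (t : ℝ) :
    ℝ :=
  ∑' r : ℝ, (Module.finrank ℂ (gradedPiece I q r) : ℝ) * t ^ r

/-- The graded pieces are finite-dimensional and the Hilbert series converges for `0 < t < 1`. -/
def HilbertSeriesConverges {ι : Type} (I : Ideal (MvPolynomial ι ℂ)) (q : ι → ℝ) : Prop :=
  (∀ r : ℝ, Module.Finite ℂ (gradedPiece I q r)) ∧
    ∀ t : ℝ, 0 < t → t < 1 →
      Summable fun r : ℝ => (Module.finrank ℂ (gradedPiece I q r) : ℝ) * t ^ r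

/-- `A₀` and `A₁` are the leading coefficients of the Laurent expansion
`g(e^{-s}) = 2 A₀ / s ^ 3 + A₁ / s ^ 2 + O(1 / s)` of the Hilbert series. -/
def HasLeadingCoeffs {ι : Type} (I : Ideal (MvPolynomial ι ℂ)) (q : ι → ℝ) (A₀ A₁ : ℝ) : Prop :=
  HilbertSeriesConverges I q ∧
    (fun s : ℝ => hilbertSeries I q (Real.exp (-s)) - (2 * A₀ / s ^ 3 + A₁ / s ^ 2))
      =O[𝓝[>] 0] fun s : ℝ => 1 / s

/-! ### Volume minimization and the `R`-symmetry -/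

/-- The charge of the generator `x_h` when the field `p_v` belonging to the extremal point `v` has
charge `b v`; the generator `x_h` is the monomial `∏_v p_v ^ ⟨x_h, (v, 1)⟩`. -/
noncomputable def charge (Δ : ReflexivePolygon) (b : Δ.vertices → ℝ) (h : Generator Δ) : ℝ :=
  ∑ v : Δ.vertices, b v * (pairing h.1.1 v.1 : ℝ)

/-- Admissible Reeb vector components: they are positive with sum `2`.  The Reeb vectors
`∑_v b_v (v, 1)` are then exactly the interior points of `σ` with last coordinate `2`. -/
def IsReeb (Δ : ReflexivePolygon) (b : Δ.vertices → ℝ) : Prop :=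
  (∀ v, 0 < b v) ∧ ∑ v : Δ.vertices, b v = 2

/-- `V` is the normalized volume `V(b; Y) = (8 / 27) lim_{s → 0} s ^ 3 g(t_v = e^{-s b_v}; 𝒳)`. -/
def HasVolume (Δ : ReflexivePolygon) (b : Δ.vertices → ℝ) (V : ℝ) : Prop :=
  HilbertSeriesConverges (toricIdeal Δ) (charge Δ b) ∧
    Tendsto (fun s : ℝ => 8 / 27 * (s ^ 3 * hilbertSeries (toricIdeal Δ) (charge Δ b)
      (Real.exp (-s)))) (𝓝[>] 0) (𝓝 V)

/-- The volume function attains its minimum over all admissible Reeb vectors at `b`, and `V` is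
the minimum.  The charges `charge Δ b` of the generators are then their `U(1)_R` charges. -/
def IsVolumeMinimum (Δ : ReflexivePolygon) (b : Δ.vertices → ℝ) (V : ℝ) : Prop :=
  IsReeb Δ b ∧ HasVolume Δ b V ∧ ∀ b', IsReeb Δ b' → ∃ V', HasVolume Δ b' V' ∧ V ≤ V'

/-! ### Futaki invariants -/

/-- `F` is the Futaki invariant `F(𝒳; ζ, η)`, where `ζ` gives the charges `q` to the generators and
`η` is the test symmetry with weights `w`.  With `n = 3`,
`F = A₀(ζ) / (n - 1) D_ε [A₁(ζ + ε η) / A₀(ζ + ε η)] + A₁(ζ) / (n (n - 1) A₀(ζ)) D_ε A₀(ζ + ε η)`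
at `ε = 0`, where the `A_i(ζ)` are taken from the Hilbert series of `𝒳` and the `A_i(ζ + ε η)` from
that of the central fibre. -/
def IsFutakiInvariant (Δ : ReflexivePolygon) (q : Generator Δ → ℝ) (w : Generator Δ → ℕ)
    (F : ℝ) : Prop :=
  ∃ (a₀ a₁ : ℝ) (A₀ A₁ : ℝ → ℝ) (D D₀ : ℝ),
    HasLeadingCoeffs (toricIdeal Δ) q a₀ a₁ ∧ a₀ ≠ 0 ∧
    (∀ᶠ ε in 𝓝 (0 : ℝ), A₀ ε ≠ 0 ∧ HasLeadingCoeffs (centralFibreIdeal (toricIdeal Δ) w)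
      (fun i => q i + ε * (w i : ℝ)) (A₀ ε) (A₁ ε)) ∧
    HasDerivAt (fun ε => A₁ ε / A₀ ε) D 0 ∧
    HasDerivAt A₀ D₀ 0 ∧
    F = a₀ / (3 - 1) * D + a₁ / (3 * (3 - 1) * a₀) * D₀

open Classical in
/-- The test symmetry `η_h`, with weight `1` on `x_h` and `0` on all other generators. -/
noncomputable def testSymmetry (Δ : ReflexivePolygon) (h : Generator Δ) : Generator Δ → ℕ :=
  Pi.single h 1

end FutakiReflexive

namespace FutakiReflexive

/-! ### Quotients of a polynomial ring with a basis of monomials -/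

open Classical in
/-- The linear map that sends a monomial `x ^ a` to the basis vector `π a` if `a` satisfies `P`, and
to zero otherwise. -/
noncomputable def standardMap {ι M : Type} (π : (ι →₀ ℕ) → M) (P : (ι →₀ ℕ) → Prop) :
    MvPolynomial ι ℂ →ₗ[ℂ] (M →₀ ℂ) :=
  (MvPolynomial.basisMonomials ι ℂ).constr ℂ
    fun a => if P a then Finsupp.single (π a) 1 else 0

open Classical in
theorem standardMap_monomial {ι M : Type} (π : (ι →₀ ℕ) → M) (P : (ι →₀ ℕ) → Prop)
    (a : ι →₀ ℕ) (c : ℂ) :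
    standardMap π P (MvPolynomial.monomial a c) = if P a then Finsupp.single (π a) c else 0 := by
  have h : MvPolynomial.monomial a c = c • MvPolynomial.basisMonomials ι ℂ a := by
    simp [MvPolynomial.smul_monomial]
  rw [h, map_smul, standardMap, Module.Basis.constr_basis]
  split_ifs <;> simp

theorem map_standardMap_weightedHomogeneousSubmodule {ι M : Type} {π : (ι →₀ ℕ) → M}
    {P : (ι →₀ ℕ) → Prop} (hsurj : ∀ m, ∃ a, P a ∧ π a = m) {q : ι → ℝ} {Q : M → ℝ}
    (hQ : ∀ a, P a → Finsupp.weight q a = Q (π a)) (r : ℝ) :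
    (MvPolynomial.weightedHomogeneousSubmodule ℂ q r).map (standardMap π P)
      = Finsupp.supported ℂ ℂ {m | Q m = r} := by
  apply le_antisymm
  · rintro _ ⟨p, hp, rfl⟩
    rw [p.as_sum, map_sum]
    refine Submodule.sum_mem _ fun a ha => ?_
    rw [standardMap_monomial]
    split_ifs with hPa
    · refine Finsupp.single_mem_supported _ _ ?_
      rw [Set.mem_ofPred_eq, ← hQ a hPa]
      exact hp (MvPolynomial.mem_support_iff.1 ha)
    · exact Submodule.zero_mem _
  · rw [Finsupp.supported_eq_span_single, Submodule.span_le]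
    rintro _ ⟨m, hm, rfl⟩
    obtain ⟨a, hPa, rfl⟩ := hsurj m
    refine ⟨MvPolynomial.monomial a 1, ?_, ?_⟩
    · exact MvPolynomial.isWeightedHomogeneous_monomial _ _ _ ((hQ a hPa).trans hm)
    · rw [standardMap_monomial, if_pos hPa]

/-- If the ideal `I` is the kernel of a `standardMap`, a graded piece of the quotient by `I` has a
basis indexed by the elements of the corresponding degree. -/
theorem nonempty_gradedPiece_equiv {ι M : Type} {I : Ideal (MvPolynomial ι ℂ)}
    {π : (ι →₀ ℕ) → M} {P : (ι →₀ ℕ) → Prop} (hI : ∀ p, p ∈ I ↔ standardMap π P p = 0)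
    (hsurj : ∀ m, ∃ a, P a ∧ π a = m) {q : ι → ℝ} {Q : M → ℝ}
    (hQ : ∀ a, P a → Finsupp.weight q a = Q (π a)) (r : ℝ) :
    Nonempty (gradedPiece I q r ≃ₗ[ℂ] ({m | Q m = r} →₀ ℂ)) := by
  set mk : MvPolynomial ι ℂ →ₗ[ℂ] (MvPolynomial ι ℂ ⧸ I) :=
    (Ideal.Quotient.mkₐ ℂ I).toLinearMap with hmk
  have hmk0 : ∀ p, mk p = 0 ↔ p ∈ I := fun p => Ideal.Quotient.eq_zero_iff_mem
  have hmks : Function.Surjective mk := Ideal.Quotient.mkₐ_surjective ℂ I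
  have hker : LinearMap.ker mk ≤ LinearMap.ker (standardMap π P) := fun p hp =>
    (hI p).1 ((hmk0 p).1 hp)
  let ψ : (MvPolynomial ι ℂ ⧸ I) →ₗ[ℂ] (M →₀ ℂ) :=
    ((LinearMap.ker mk).liftQ (standardMap π P) hker).comp
      (mk.quotKerEquivOfSurjective hmks).symm.toLinearMap
  have hψ : ∀ p, ψ (mk p) = standardMap π P p := by
    intro p
    have : (mk.quotKerEquivOfSurjective hmks).symm (mk p) = (LinearMap.ker mk).mkQ p := by
      rw [LinearEquiv.symm_apply_eq]; rfl
    simp only [ψ, LinearMap.comp_apply, LinearEquiv.coe_coe, this]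
    rfl
  have hinj : Function.Injective ψ := by
    rw [← LinearMap.ker_eq_bot, LinearMap.ker_eq_bot']
    intro x hx
    obtain ⟨p, rfl⟩ := hmks x
    rw [hψ] at hx
    exact (hmk0 p).2 ((hI p).2 hx)
  have himg : (gradedPiece I q r).map ψ = Finsupp.supported ℂ ℂ {m | Q m = r} := by
    rw [← map_standardMap_weightedHomogeneousSubmodule hsurj hQ r, gradedPiece,
      ← Submodule.map_comp]
    congr 1
    exact LinearMap.ext hψ
  exact ⟨((Submodule.equivMapOfInjective ψ hinj _).trans (LinearEquiv.ofEq _ _ himg)).trans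
    (Finsupp.supportedEquivFinsupp _)⟩

/-- The Hilbert series of a quotient with a monomial basis is the sum over that basis. -/
theorem hilbertSeries_eq_tsum {ι M : Type} {I : Ideal (MvPolynomial ι ℂ)}
    {π : (ι →₀ ℕ) → M} {P : (ι →₀ ℕ) → Prop} (hI : ∀ p, p ∈ I ↔ standardMap π P p = 0)
    (hsurj : ∀ m, ∃ a, P a ∧ π a = m) {q : ι → ℝ} {Q : M → ℝ}
    (hQ : ∀ a, P a → Finsupp.weight q a = Q (π a)) {g : ℝ → ℝ}
    (hs : ∀ t : ℝ, 0 < t → t < 1 → HasSum (fun m => t ^ Q m) (g t)) :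
    HilbertSeriesConverges I q ∧ ∀ t : ℝ, 0 < t → t < 1 → hilbertSeries I q t = g t := by
  have e := nonempty_gradedPiece_equiv hI hsurj hQ
  have hfin : ∀ r, Finite {m | Q m = r} := by
    intro r
    -- Convergence at the single value t = 1 / 2 forces finite fibres: on an infinite fibre a
    -- nonzero constant would be summable.
    have h1 := (hs (1 / 2) (by norm_num) (by norm_num)).summable.comp_injective
      (Subtype.val_injective (p := fun m => m ∈ {m | Q m = r}))
    have h2 : Summable fun _ : {m | Q m = r} => ((1 / 2 : ℝ) ^ r) := by
      refine h1.congr fun m => ?_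
      have : Q m.1 = r := m.2
      simp [this]
    by_contra hinf
    rw [not_finite_iff_infinite] at hinf
    have := (summable_const_iff (β := {m | Q m = r}) _).1 h2
    exact (Real.rpow_pos_of_pos (by norm_num : (0:ℝ) < 1 / 2) r).ne' this
  have hmod : ∀ r, Module.Finite ℂ (gradedPiece I q r) := by
    intro r
    obtain ⟨e⟩ := e r
    have := hfin r
    exact Module.Finite.equiv e.symm
  have hrank : ∀ r, Module.finrank ℂ (gradedPiece I q r) = Nat.card {m | Q m = r} := by
    intro r
    obtain ⟨e⟩ := e r
    have := hfin r
    have := Fintype.ofFinite {m | Q m = r}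
    rw [e.finrank_eq, Module.finrank_finsupp_self, Nat.card_eq_fintype_card]
  have key : ∀ t : ℝ, 0 < t → t < 1 →
      HasSum (fun r : ℝ => (Module.finrank ℂ (gradedPiece I q r) : ℝ) * t ^ r) (g t) := by
    intro t h0 h1
    have hs' := (Equiv.sigmaFiberEquiv Q).hasSum_iff.2 (hs t h0 h1)
    refine hs'.sigma fun r => ?_
    have := hfin r
    have hF : Finite {m // Q m = r} := hfin r
    have := Fintype.ofFinite {m // Q m = r}
    rw [hrank]
    have h3 : (fun c : {m // Q m = r} => ((fun m => t ^ Q m) ∘ (Equiv.sigmaFiberEquiv Q)) ⟨r, c⟩)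
        = fun _ => t ^ r := by
      funext c
      simp [Equiv.sigmaFiberEquiv, c.2]
    rw [h3]
    have h4 := hasSum_fintype (fun _ : {m // Q m = r} => t ^ r)
    rw [Finset.sum_const, Finset.card_univ, ← Nat.card_eq_fintype_card, nsmul_eq_mul] at h4
    exact h4
  exact ⟨⟨hmod, fun t h0 h1 => (key t h0 h1).summable⟩, fun t h0 h1 => (key t h0 h1).tsum_eq⟩

/-! ### The toric ideal and the ideal of the central fibre -/

/-- The element of the monoid represented by a monomial in the generators. -/
noncomputable def degreeMap (Δ : ReflexivePolygon) :
    (Generator Δ →₀ ℕ) →ₗ[ℕ] dualMonoid Δ :=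
  Finsupp.linearCombination ℕ fun h : Generator Δ => h.1

theorem degreeMap_single (Δ : ReflexivePolygon) (h : Generator Δ) (n : ℕ) :
    degreeMap Δ (Finsupp.single h n) = n • h.1 := by
  simp [degreeMap]

theorem presentation_monomial (Δ : ReflexivePolygon) (a : Generator Δ →₀ ℕ) (c : ℂ) :
    presentation Δ (MvPolynomial.monomial a c) = AddMonoidAlgebra.single (degreeMap Δ a) c := by
  have h : ∀ a : Generator Δ →₀ ℕ,
      (a.prod fun i k => (AddMonoidAlgebra.single i.1 (1 : ℂ) : CoordinateRing Δ) ^ k)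
        = AddMonoidAlgebra.single (degreeMap Δ a) 1 := by
    intro a
    induction a using Finsupp.induction_linear with
    | zero => simp [AddMonoidAlgebra.one_def]
    | add f g hf hg =>
      rw [Finsupp.prod_add_index' (by simp) (by intros; rw [pow_add]), hf, hg, map_add,
        AddMonoidAlgebra.single_mul_single, one_mul]
    | single i n =>
      rw [Finsupp.prod_single_index (by simp), degreeMap_single, AddMonoidAlgebra.single_pow,
        one_pow]
  rw [presentation, MvPolynomial.aeval_monomial, h, ← Algebra.smul_def,
    AddMonoidAlgebra.smul_single, smul_eq_mul, mul_one]

theorem mem_toricIdeal_iff (Δ : ReflexivePolygon) (p : MvPolynomial (Generator Δ) ℂ) :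
    p ∈ toricIdeal Δ ↔ standardMap (degreeMap Δ) (fun _ => True) p = 0 := by
  have h : (AddMonoidAlgebra.coeffLinearEquiv ℂ).toLinearMap ∘ₗ (presentation Δ).toLinearMap
      = standardMap (degreeMap Δ) (fun _ => True) := by
    refine (MvPolynomial.basisMonomials _ ℂ).ext fun a => ?_
    simp [standardMap_monomial, presentation_monomial, AddMonoidAlgebra.coeffLinearEquiv]
  rw [← h, toricIdeal, RingHom.mem_ker]
  simp

theorem weight_testSymmetry (Δ : ReflexivePolygon) (h : Generator Δ) (a : Generator Δ →₀ ℕ) :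
    Finsupp.weight (testSymmetry Δ h) a = a h := by
  classical
  rw [testSymmetry, Finsupp.weight_apply, Finsupp.sum, Finset.sum_eq_single h]
  · simp
  · intro b _ hb; simp [hb]
  · intro hb; simp [Finsupp.notMem_support_iff.1 hb]

theorem weightedHomogeneousComponent_monomial {ι : Type} (w : ι → ℕ) (d : ℕ) (a : ι →₀ ℕ) (c : ℂ) :
    MvPolynomial.weightedHomogeneousComponent w d (MvPolynomial.monomial a c)
      = if Finsupp.weight w a = d then MvPolynomial.monomial a c else 0 := by
  classical
  rw [MvPolynomial.weightedHomogeneousComponent_of_mem (n := Finsupp.weight w a)]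
  · simp only [eq_comm]
  · exact MvPolynomial.isWeightedHomogeneous_monomial _ _ _ rfl

/-- The toric ideal contains the differences of monomials of the same degree. -/
theorem monomial_sub_mem_toricIdeal (Δ : ReflexivePolygon) {a a' : Generator Δ →₀ ℕ}
    (h : degreeMap Δ a = degreeMap Δ a') (c : ℂ) :
    MvPolynomial.monomial a c - MvPolynomial.monomial a' c ∈ toricIdeal Δ := by
  rw [mem_toricIdeal_iff, map_sub, standardMap_monomial, standardMap_monomial, h, sub_self]

theorem standardMap_apply {ι M : Type} (π : (ι →₀ ℕ) → M) (P : (ι →₀ ℕ) → Prop)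
    [DecidablePred P] [DecidableEq M] (p : MvPolynomial ι ℂ) (m : M) :
    standardMap π P p m = ∑ a ∈ p.support, if P a ∧ π a = m then p.coeff a else 0 := by
  conv_lhs => rw [p.as_sum, map_sum, Finsupp.finsetSum_apply]
  refine Finset.sum_congr rfl fun a _ => ?_
  rw [standardMap_monomial]
  by_cases hP : P a
  · simp [hP, Finsupp.single_apply]
  · simp [hP]

section CentralFibre

variable {Δ : ReflexivePolygon} {h : Generator Δ} {k : dualMonoid Δ → ℕ}

/-- The lowest weight part of an element of the toric ideal only involves cancelling standard
monomials. -/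
theorem standardMap_lowest_eq_zero (hk : ∀ a, a h ≤ k (degreeMap Δ a))
    {f : MvPolynomial (Generator Δ) ℂ} (hf : f ∈ toricIdeal Δ) {d : ℕ}
    (hd : ∀ e < d, MvPolynomial.weightedHomogeneousComponent (testSymmetry Δ h) e f = 0) :
    standardMap (degreeMap Δ) (fun a => a h = k (degreeMap Δ a))
      (MvPolynomial.weightedHomogeneousComponent (testSymmetry Δ h) d f) = 0 := by
  classical
  have hlow : ∀ a ∈ f.support, d ≤ a h := by
    intro a ha
    by_contra hlt
    have := congrArg (MvPolynomial.coeff a) (hd (a h) (not_le.1 hlt))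
    rw [MvPolynomial.coeff_weightedHomogeneousComponent, weight_testSymmetry, if_pos rfl] at this
    exact MvPolynomial.mem_support_iff.1 ha (by simpa using this)
  rw [mem_toricIdeal_iff] at hf
  ext m
  have hfm := DFunLike.congr_fun hf m
  rw [standardMap_apply] at hfm
  conv_lhs => rw [f.as_sum]
  simp only [map_sum, Finsupp.finsetSum_apply, weightedHomogeneousComponent_monomial,
    weight_testSymmetry]
  -- If k m = d, every monomial of f lying over m has weight between d and k m, so all of them
  -- survive in the component and are standard; their coefficients cancel because f is in the toric
  -- ideal. If k m ≠ d, no standard monomial of weight d lies over m.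
  by_cases hm : k m = d
  · refine Eq.trans ?_ hfm
    refine Finset.sum_congr rfl fun a ha => ?_
    have h1 := hlow a ha
    have h2 := hk a
    by_cases ham : degreeMap Δ a = m
    · rw [ham, hm] at h2
      have h3 : a h = d := le_antisymm h2 h1
      rw [if_pos h3, standardMap_monomial, if_pos (by rw [ham, hm, h3])]
      simp [ham]
    · split_ifs <;> simp_all [standardMap_monomial]
      split_ifs <;> simp [ham]
  · refine Finset.sum_eq_zero fun a _ => ?_
    split_ifs with h1
    · rw [standardMap_monomial]
      split_ifs with h2
      · refine Finsupp.single_eq_of_ne fun h3 => hm ?_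
        rw [h3, ← h2, h1]
      · rfl
    · simp

/-- Superadditivity b h + k m ≤ k (deg b + m) keeps a nonstandard monomial nonstandard after
multiplication. Multiplication by a monomial therefore descends through `standardMap` to the linear
map `ψ`, so the kernel is stable under it. -/
theorem standardMap_monomial_mul (hk : ∀ a, a h ≤ k (degreeMap Δ a))
    (hk' : ∀ m, ∃ a, degreeMap Δ a = m ∧ a h = k m) (b : Generator Δ →₀ ℕ) (c : ℂ)
    {p : MvPolynomial (Generator Δ) ℂ}
    (hp : standardMap (degreeMap Δ) (fun a => a h = k (degreeMap Δ a)) p = 0) :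
    standardMap (degreeMap Δ) (fun a => a h = k (degreeMap Δ a))
      (MvPolynomial.monomial b c * p) = 0 := by
  classical
  set φ := standardMap (degreeMap Δ) (fun a => a h = k (degreeMap Δ a)) with hφ
  let ψ : (dualMonoid Δ →₀ ℂ) →ₗ[ℂ] (dualMonoid Δ →₀ ℂ) :=
    Finsupp.linearCombination ℂ fun m =>
      if b h + k m = k (degreeMap Δ b + m) then Finsupp.single (degreeMap Δ b + m) c else 0
  have key : φ ∘ₗ LinearMap.mulLeft ℂ (MvPolynomial.monomial b c) = ψ ∘ₗ φ := by
    refine (MvPolynomial.basisMonomials _ ℂ).ext fun a => ?_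
    have hle : b h + k (degreeMap Δ a) ≤ k (degreeMap Δ b + degreeMap Δ a) := by
      obtain ⟨a', ha', hka'⟩ := hk' (degreeMap Δ a)
      have := hk (b + a')
      rwa [map_add, ha', Finsupp.add_apply, hka'] at this
    have hka := hk a
    simp only [LinearMap.comp_apply, MvPolynomial.coe_basisMonomials, LinearMap.mulLeft_apply,
      MvPolynomial.monomial_mul, mul_one, hφ, standardMap_monomial, map_add, Finsupp.add_apply]
    by_cases h1 : a h = k (degreeMap Δ a)
    · simp [ψ, h1]
    · rw [if_neg (by omega), if_neg h1, map_zero]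
  have := LinearMap.congr_fun key p
  simpa [hp] using this

/-- The hypotheses say that k m is the largest exponent of x_h among the monomials representing m.
The central fibre kills the monomials with a smaller exponent and identifies those attaining it, so
it again has a basis indexed by the monoid. -/
theorem mem_centralFibreIdeal_iff (hk : ∀ a, a h ≤ k (degreeMap Δ a))
    (hk' : ∀ m, ∃ a, degreeMap Δ a = m ∧ a h = k m) (p : MvPolynomial (Generator Δ) ℂ) :
    p ∈ centralFibreIdeal (toricIdeal Δ) (testSymmetry Δ h) ↔
      standardMap (degreeMap Δ) (fun a => a h = k (degreeMap Δ a)) p = 0 := by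
  set φ := standardMap (degreeMap Δ) (fun a => a h = k (degreeMap Δ a)) with hφ
  constructor
  · intro hp
    induction hp using Submodule.span_induction with
    | mem x hx =>
      obtain ⟨f, hf, d, hd, rfl⟩ := hx
      exact standardMap_lowest_eq_zero hk hf hd
    | zero => exact map_zero _
    | add x y _ _ hx hy => rw [map_add, hx, hy, add_zero]
    | smul r x _ hx =>
      rw [r.as_sum, smul_eq_mul, Finset.sum_mul, map_sum]
      exact Finset.sum_eq_zero fun b _ => standardMap_monomial_mul hk hk' b _ hx
  · intro hp
    choose A hA hA' using hk'
    let s : (dualMonoid Δ →₀ ℂ) →ₗ[ℂ] MvPolynomial (Generator Δ) ℂ :=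
      Finsupp.linearCombination ℂ fun m => MvPolynomial.monomial (A m) 1
    -- Subtract from a monomial the chosen standard monomial of the same degree. The lowest weight
    -- part of this binomial is the monomial itself if it is not standard, and the whole binomial if
    -- it is.
    have key : ∀ q, q - s (φ q) ∈ centralFibreIdeal (toricIdeal Δ) (testSymmetry Δ h) := by
      intro q
      induction q using MvPolynomial.induction_on' with
      | add x y hx hy =>
        rw [map_add, map_add, add_sub_add_comm]
        exact add_mem hx hy
      | monomial a c =>
        have hle := hk a
        have hmem := monomial_sub_mem_toricIdeal Δ (hA (degreeMap Δ a)).symm c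
        refine Submodule.subset_span ⟨_, hmem, a h, fun e he => ?_, ?_⟩
        · rw [map_sub, weightedHomogeneousComponent_monomial,
            weightedHomogeneousComponent_monomial, weight_testSymmetry, weight_testSymmetry,
            hA', if_neg (by omega), if_neg (by omega), sub_zero]
        · rw [map_sub, weightedHomogeneousComponent_monomial,
            weightedHomogeneousComponent_monomial, weight_testSymmetry, weight_testSymmetry,
            hA', if_pos rfl, hφ, standardMap_monomial]
          by_cases h1 : a h = k (degreeMap Δ a)
          · rw [if_pos h1, if_pos h1.symm]
            simp [s, MvPolynomial.smul_monomial]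
          · rw [if_neg h1, if_neg (Ne.symm h1), map_zero]
    have := key p
    rwa [hp, map_zero, sub_zero] at this

end CentralFibre

/-! ### First order expansions at `0` from the right -/

/-- `f s = c₀ + c₁ s + O(s ^ 2)` as `s → 0+`. -/
def HasExpansion (f : ℝ → ℝ) (c₀ c₁ : ℝ) : Prop :=
  (fun s => f s - (c₀ + c₁ * s)) =O[𝓝[>] 0] fun s => s ^ 2

namespace HasExpansion

variable {f g : ℝ → ℝ} {c₀ c₁ d₀ d₁ : ℝ}

theorem congr' (hf : HasExpansion f c₀ c₁) (h : f =ᶠ[𝓝[>] 0] g) : HasExpansion g c₀ c₁ :=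
  IsBigO.congr' hf (h.mono fun s hs => by simp only [hs]) EventuallyEq.rfl

theorem affine (c₀ c₁ : ℝ) : HasExpansion (fun s => c₀ + c₁ * s) c₀ c₁ := by
  simpa [HasExpansion] using isBigO_zero _ _

theorem tendsto_sq : Tendsto (fun s : ℝ => s ^ 2) (𝓝[>] 0) (𝓝 0) := by
  have : Tendsto (fun s : ℝ => s ^ 2) (𝓝 0) (𝓝 (0 ^ 2)) := (continuous_pow 2).tendsto 0
  rw [zero_pow two_ne_zero] at this
  exact this.mono_left nhdsWithin_le_nhds

theorem tendsto_affine (c₀ c₁ : ℝ) :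
    Tendsto (fun s : ℝ => c₀ + c₁ * s) (𝓝[>] 0) (𝓝 c₀) := by
  have : Tendsto (fun s : ℝ => c₀ + c₁ * s) (𝓝 0) (𝓝 (c₀ + c₁ * 0)) :=
    (by fun_prop : Continuous fun s : ℝ => c₀ + c₁ * s).tendsto 0
  rw [mul_zero, add_zero] at this
  exact this.mono_left nhdsWithin_le_nhds

theorem tendsto (hf : HasExpansion f c₀ c₁) : Tendsto f (𝓝[>] 0) (𝓝 c₀) := by
  have := (hf.trans_tendsto tendsto_sq).add (tendsto_affine c₀ c₁)
  simpa using this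

theorem isBigO_one (hf : HasExpansion f c₀ c₁) : f =O[𝓝[>] 0] fun _ => (1 : ℝ) :=
  hf.tendsto.isBigO_one ℝ

theorem of_coeffs (hf : HasExpansion f c₀ c₁) (h₀ : c₀ = d₀) (h₁ : c₁ = d₁) :
    HasExpansion f d₀ d₁ := h₀ ▸ h₁ ▸ hf

theorem add (hf : HasExpansion f c₀ c₁) (hg : HasExpansion g d₀ d₁) :
    HasExpansion (fun s => f s + g s) (c₀ + d₀) (c₁ + d₁) := by
  refine (IsBigO.add hf hg).congr_left fun s => ?_
  ring

theorem sum {ι : Type*} {s : Finset ι} {F : ι → ℝ → ℝ} {c d : ι → ℝ}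
    (h : ∀ i ∈ s, HasExpansion (F i) (c i) (d i)) :
    HasExpansion (fun x => ∑ i ∈ s, F i x) (∑ i ∈ s, c i) (∑ i ∈ s, d i) := by
  refine (IsBigO.sum h).congr_left fun x => ?_
  rw [Finset.sum_apply, Finset.sum_sub_distrib, Finset.sum_add_distrib, Finset.sum_mul]

theorem mul (hf : HasExpansion f c₀ c₁) (hg : HasExpansion g d₀ d₁) :
    HasExpansion (fun s => f s * g s) (c₀ * d₀) (c₀ * d₁ + c₁ * d₀) := by
  have h1 : (fun s => (f s - (c₀ + c₁ * s)) * g s) =O[𝓝[>] 0] fun s => s ^ 2 := by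
    simpa using IsBigO.mul hf hg.isBigO_one
  have h2 : (fun s => (g s - (d₀ + d₁ * s)) * (c₀ + c₁ * s)) =O[𝓝[>] 0] fun s => s ^ 2 := by
    simpa using IsBigO.mul hg (affine c₀ c₁).isBigO_one
  have h3 : (fun s : ℝ => c₁ * d₁ * s ^ 2) =O[𝓝[>] 0] fun s => s ^ 2 :=
    isBigO_const_mul_self _ _ _
  refine ((h1.add h2).add h3).congr_left fun s => ?_
  ring

theorem inv (hf : HasExpansion f c₀ c₁) (h0 : c₀ ≠ 0) :
    HasExpansion (fun s => (f s)⁻¹) c₀⁻¹ (-c₁ / c₀ ^ 2) := by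
  have h1 := (hf.mul (affine c₀⁻¹ (-c₁ / c₀ ^ 2))).of_coeffs (d₀ := 1) (d₁ := 0)
    (mul_inv_cancel₀ h0) (by field_simp; ring)
  have h2 : (fun s => (f s)⁻¹) =O[𝓝[>] 0] fun _ => (1 : ℝ) := (hf.tendsto.inv₀ h0).isBigO_one ℝ
  have h3 := (IsBigO.mul h1 h2).neg_left
  have hne : ∀ᶠ s in 𝓝[>] 0, f s ≠ 0 := hf.tendsto.eventually_ne h0
  refine h3.congr' (hne.mono fun s hs => ?_) (by simp)
  simp only
  field_simp
  ring

/-- This is what makes A₀ and A₁, and with them the Futaki invariant, well defined. -/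
theorem unique (hf : HasExpansion f c₀ c₁) (hg : HasExpansion f d₀ d₁) : c₀ = d₀ ∧ c₁ = d₁ := by
  have h0 : c₀ = d₀ := tendsto_nhds_unique hf.tendsto hg.tendsto
  refine ⟨h0, ?_⟩
  subst h0
  have h1 : (fun s => (d₁ - c₁) * s) =O[𝓝[>] 0] fun s : ℝ => s ^ 2 :=
    (IsBigO.sub hf hg).congr_left fun s => by ring
  have h2 : (fun _ => d₁ - c₁) =O[𝓝[>] 0] fun s : ℝ => s := by
    refine (h1.mul (isBigO_refl (fun s : ℝ => s⁻¹) _)).congr' ?_ ?_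
    · filter_upwards [self_mem_nhdsWithin] with s hs
      have : s ≠ 0 := ne_of_gt hs
      field_simp
    · filter_upwards [self_mem_nhdsWithin] with s hs
      have : s ≠ 0 := ne_of_gt hs
      field_simp
  have h3 : Tendsto (fun s : ℝ => s) (𝓝[>] 0) (𝓝 0) := tendsto_id.mono_left nhdsWithin_le_nhds
  have := tendsto_nhds_unique (h2.trans_tendsto h3) tendsto_const_nhds
  linarith

end HasExpansion

theorem hasExpansion_one_sub_exp (R : ℝ) :
    HasExpansion (fun s => (1 - Real.exp (-s) ^ R) / s) R (-R ^ 2 / 2) := by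
  have h0 : Tendsto (fun s : ℝ => -s * R) (𝓝[>] 0) (𝓝 0) := by
    have : Tendsto (fun s : ℝ => -s * R) (𝓝 0) (𝓝 (-0 * R)) :=
      (by fun_prop : Continuous fun s : ℝ => -s * R).tendsto 0
    simp only [neg_zero, zero_mul] at this
    exact this.mono_left nhdsWithin_le_nhds
  have h1 := (Real.exp_sub_sum_range_isBigO_pow 3).comp_tendsto h0
  have h2 : (fun s => Real.exp (-s) ^ R - (1 - s * R + s ^ 2 * R ^ 2 / 2)) =O[𝓝[>] 0]
      fun s : ℝ => s ^ 3 := by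
    refine (h1.congr_left fun s => ?_).trans ?_
    · simp only [Function.comp_apply, Finset.sum_range_succ, Finset.sum_range_zero,
        ← Real.exp_mul, Nat.factorial]
      push_cast
      ring
    · refine (isBigO_const_mul_self (-R ^ 3) (fun s : ℝ => s ^ 3) _).congr_left fun s => ?_
      simp only [Function.comp_apply]
      ring
  refine ((h2.neg_left).mul (isBigO_refl (fun s : ℝ => s⁻¹) _)).congr' ?_ ?_
  · filter_upwards [self_mem_nhdsWithin] with s hs
    have : s ≠ 0 := ne_of_gt hs
    field_simp
    ring
  · filter_upwards [self_mem_nhdsWithin] with s hs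
    have : s ≠ 0 := ne_of_gt hs
    field_simp

/-- The second coefficient 1 / 2 does not depend on R; this causes the telescoping in
`hasExpansion_series`. -/
theorem hasExpansion_geometric {R : ℝ} (hR : 0 < R) :
    HasExpansion (fun s => s * (1 - Real.exp (-s) ^ R)⁻¹) R⁻¹ (1 / 2) := by
  have h := ((hasExpansion_one_sub_exp R).inv hR.ne').of_coeffs rfl
    (show -(-R ^ 2 / 2) / R ^ 2 = 1 / 2 by field_simp)
  refine h.congr' (Eventually.of_forall fun s => ?_)
  simp only [inv_div]
  rw [div_eq_mul_inv]

theorem hasLeadingCoeffs_iff {ι : Type} {I : Ideal (MvPolynomial ι ℂ)} {q : ι → ℝ} {A₀ A₁ : ℝ}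
    (h : HilbertSeriesConverges I q) : HasLeadingCoeffs I q A₀ A₁ ↔
      HasExpansion (fun s => s ^ 3 * hilbertSeries I q (Real.exp (-s))) (2 * A₀) A₁ := by
  have hs : ∀ᶠ s : ℝ in 𝓝[>] 0, s ≠ 0 := by
    filter_upwards [self_mem_nhdsWithin] with s hs using ne_of_gt hs
  constructor
  · rintro ⟨-, h1⟩
    refine (h1.mul (isBigO_refl (fun s : ℝ => s ^ 3) _)).congr' ?_ ?_
    · filter_upwards [hs] with s hs
      field_simp
    · filter_upwards [hs] with s hs
      field_simp
  · intro h1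
    refine ⟨h, ?_⟩
    refine (IsBigO.mul h1 (isBigO_refl (fun s : ℝ => (s ^ 3)⁻¹) _)).congr' ?_ ?_
    · filter_upwards [hs] with s hs
      field_simp
    · filter_upwards [hs] with s hs
      field_simp

/-! ### The boundary lattice points of the dual polygon -/

/-- The determinant of two vectors of `ℤ²`. -/
def cross (u v : ℤ × ℤ) : ℤ := u.1 * v.2 - u.2 * v.1

/-- The lattice points `u 0, …, u n = u 0` on the boundary of the dual polygon, in counterclockwise
order, with the properties of this cycle that determine the cone over the dual polygon. -/
structure BoundaryCycle (Δ : ReflexivePolygon) where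
  /-- the number of points -/
  n : ℕ
  /-- the points -/
  u : ℕ → ℤ × ℤ
  pos : 0 < n
  closed : u n = u 0
  unimodular : ∀ i < n, cross (u i) (u (i + 1)) = 1
  convex : ∀ j < n, ∀ i < n, 0 ≤ cross (u i - u j) (u (i + 1) - u j)
  mem_polar : ∀ i < n, ∀ v ∈ Δ.vertices, -1 ≤ dot (u i) v
  facet : ∀ i < n, ∃ v ∈ Δ.vertices, dot (u i) v = -1 ∧ dot (u (i + 1)) v = -1
  -- Distinct half-open cones are disjoint: a linear form is positive on one (strictness is needed
  -- only on the ray with positive coefficient) and nonpositive on the other. The bounded box for c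
  -- keeps the condition decidable.
  separated : ∀ i < n, ∀ j < n, i = j ∨ ∃ c ∈ (Finset.Icc (-2) 2 ×ˢ Finset.Icc (-2) 2 :
    Finset (ℤ × ℤ)), (0 < dot c (u i) ∧ 0 ≤ dot c (u (i + 1)) ∧ dot c (u j) ≤ 0 ∧
      dot c (u (j + 1)) ≤ 0) ∨ (0 < dot c (u j) ∧ 0 ≤ dot c (u (j + 1)) ∧ dot c (u i) ≤ 0 ∧
      dot c (u (i + 1)) ≤ 0)
  -- By Cramer's rule this says that -u j lies in the cone spanned by u i and u (i + 1), so the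
  -- cycle goes around the origin.
  opposite : ∀ j < n, ∃ i < n, 0 ≤ cross (u j) (u i) ∧ 0 ≤ cross (u (i + 1)) (u j)
  interior : ∀ i < n, ∃ v ∈ Δ.vertices, 1 ≤ dot (u i) v

namespace BoundaryCycle

variable {Δ : ReflexivePolygon} (C : BoundaryCycle Δ)

/-- A real linear form on the plane, given by its coefficients, at a lattice point. -/
def form (y : ℝ × ℝ) (u : ℤ × ℤ) : ℝ := y.1 * u.1 + y.2 * u.2

theorem eq_combination {u w : ℤ × ℤ} (h : cross u w = 1) (y : ℝ × ℝ) (x : ℤ × ℤ) :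
    form y x = (cross x w : ℝ) * form y u + (cross u x : ℝ) * form y w := by
  have h' : (u.1 : ℝ) * w.2 - u.2 * w.1 = 1 := by
    have := h; unfold cross at this; exact_mod_cast this
  simp only [form, cross]
  push_cast
  linear_combination (-(y.1 * x.1 + y.2 * x.2)) * h'

theorem mem_polar_succ {i : ℕ} (hi : i < C.n) : ∀ v ∈ Δ.vertices, -1 ≤ dot (C.u (i + 1)) v := by
  rcases Nat.lt_or_ge (i + 1) C.n with h | h
  · exact C.mem_polar _ h
  · have : i + 1 = C.n := by omega
    rw [this, C.closed]
    exact C.mem_polar 0 C.pos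

theorem forall_le {p : ℤ × ℤ → Prop} (h : ∀ i < C.n, p (C.u i)) : ∀ i ≤ C.n, p (C.u i) := by
  intro i hi
  rcases Nat.lt_or_ge i C.n with h' | h'
  · exact h i h'
  · have : i = C.n := by omega
    rw [this, C.closed]
    exact h 0 C.pos

/-- A linear form that is nonnegative on the boundary cycle vanishes. -/
theorem form_eq_zero {y : ℝ × ℝ} (h : ∀ i < C.n, 0 ≤ form y (C.u i)) : y = 0 := by
  have hle := C.forall_le (p := fun u => 0 ≤ form y u) h
  have h0 : ∀ j < C.n, form y (C.u j) = 0 := by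
    intro j hj
    obtain ⟨i, hi, h1, h2⟩ := C.opposite j hj
    have e := eq_combination (C.unimodular i hi) y (C.u j)
    have a1 : (cross (C.u j) (C.u (i + 1)) : ℝ) ≤ 0 := by
      have : cross (C.u j) (C.u (i + 1)) ≤ 0 := by simp only [cross] at *; linarith
      exact_mod_cast this
    have a2 : (cross (C.u i) (C.u j) : ℝ) ≤ 0 := by
      have : cross (C.u i) (C.u j) ≤ 0 := by simp only [cross] at *; linarith
      exact_mod_cast this
    have b1 := mul_nonpos_of_nonpos_of_nonneg a1 (h i hi)
    have b2 := mul_nonpos_of_nonpos_of_nonneg a2 (hle (i + 1) hi)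
    linarith [h j hj]
  have h0' := C.forall_le (p := fun u => form y u = 0) h0
  have e0 := h0 0 C.pos
  have e1 := h0' (0 + 1) C.pos
  have c := C.unimodular 0 C.pos
  ext
  · have := eq_combination c y (1, 0)
    rw [e0, e1] at this
    simpa [form] using this
  · have := eq_combination c y (0, 1)
    rw [e0, e1] at this
    simpa [form] using this

/-- The half-open cones spanned by consecutive points cover the dual plane minus the origin. -/
theorem exists_sector {x : ℝ × ℝ} (hx : x ≠ 0) : ∃ i < C.n,
    0 ≤ (C.u i).1 * x.2 - (C.u i).2 * x.1 ∧
      (C.u (i + 1)).1 * x.2 - (C.u (i + 1)).2 * x.1 < 0 := by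
  -- The sign of cross (u i) x would never pass from nonnegative to negative. Since the cycle closes
  -- up it would then be constant, and `form_eq_zero` excludes this for x ≠ 0.
  by_contra! hno
  have hx' : ((x.2, -x.1) : ℝ × ℝ) ≠ 0 := by
    intro h
    simp only [Prod.mk_eq_zero, neg_eq_zero] at h
    exact hx (Prod.ext h.2 h.1)
  have hx'' : ((-x.2, x.1) : ℝ × ℝ) ≠ 0 := by
    intro h
    simp only [Prod.mk_eq_zero, neg_eq_zero] at h
    exact hx (Prod.ext h.2 h.1)
  have up : ∀ i j, i ≤ j → j ≤ C.n → 0 ≤ (C.u i).1 * x.2 - (C.u i).2 * x.1 →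
      0 ≤ (C.u j).1 * x.2 - (C.u j).2 * x.1 := by
    intro i j hij
    induction j, hij using Nat.le_induction with
    | base => exact fun _ h => h
    | succ j _ ih => exact fun hj h => hno j (by omega) (ih (by omega) h)
  by_cases h : ∃ i < C.n, 0 ≤ (C.u i).1 * x.2 - (C.u i).2 * x.1
  · obtain ⟨i, hi, h1⟩ := h
    have h2 := up i C.n hi.le le_rfl h1
    rw [C.closed] at h2
    refine hx' (C.form_eq_zero fun j hj => ?_)
    have := up 0 j (Nat.zero_le _) hj.le h2
    simp only [form]; linarith
  · push Not at h
    refine hx'' (C.form_eq_zero fun j hj => ?_)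
    have := h j hj
    simp only [form]; linarith

end BoundaryCycle

/-! ### The boundary cycles of the models -/

/-- The lattice points on the boundaries of the dual polygons of Models 1, …, 16 in
counterclockwise order, with the first point repeated at the end. -/
def modelBoundary : Fin 16 → List (ℤ × ℤ) :=
  ![[(1, 0), (0, 1), (-1, -1), (1, 0)],
    [(1, 0), (-1, 1), (-1, 0), (-1, -1), (1, 0)],
    [(1, 0), (0, 1), (-1, 0), (-1, -1), (1, 0)],
    [(1, 0), (0, 1), (-1, 0), (0, -1), (1, 0)],
    [(1, 0), (0, 1), (-1, 1), (-1, 0), (-1, -1), (1, 0)],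
    [(1, 0), (0, 1), (-1, 0), (0, -1), (1, -1), (1, 0)],
    [(1, 0), (-1, 1), (-1, 0), (-1, -1), (-1, -2), (0, -1), (1, 0)],
    [(1, 0), (0, 1), (-1, 1), (-2, 1), (-1, 0), (0, -1), (1, 0)],
    [(1, 0), (0, 1), (-1, 1), (-1, 0), (-1, -1), (0, -1), (1, 0)],
    [(1, 0), (0, 1), (-1, 1), (-1, 0), (0, -1), (1, -1), (1, 0)],
    [(1, 0), (0, 1), (-1, 0),
      (-2, -1), (-1, -1), (0, -1), (1, -1), (1, 0)],
    [(1, 0), (0, 1), (-1, 1), (-1, 0), (-1, -1), (0, -1), (1, -1), (1, 0)],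
    [(1, 0), (0, 1), (-1, 2), (-1, 1), (-1, 0), (-1, -1), (-1, -2), (0, -1), (1, 0)],
    [(1, 1), (0, 1), (-1, 0),
      (-2, -1), (-1, -1), (0, -1), (1, -1), (1, 0), (1, 1)],
    [(1, 1), (0, 1), (-1, 1), (-1, 0), (-1, -1), (0, -1), (1, -1), (1, 0), (1, 1)],
    [(1, 1), (0, 1), (-1, 1), (-2, 1), (-1, 0), (0, -1), (1, -2), (1, -1), (1, 0), (1, 1)]]

/-- The boundary cycle of the dual polygon of a model. -/
def modelCycle (a : Fin 16) : BoundaryCycle (model a) where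
  n := (modelBoundary a).length - 1
  u i := (modelBoundary a).getD i 0
  pos := by revert a; decide +kernel
  closed := by revert a; decide +kernel
  unimodular := by revert a; decide +kernel
  convex := by revert a; decide +kernel
  mem_polar := by
    change ∀ i < _, ∀ v ∈ modelVertices a, _
    revert a; decide +kernel
  facet := by
    change ∀ i < _, ∃ v ∈ modelVertices a, _
    revert a; decide +kernel
  separated := by revert a; decide +kernel
  opposite := by revert a; decide +kernel
  interior := by
    change ∀ i < _, ∃ v ∈ modelVertices a, _
    revert a; decide +kernel

/-- A boundary point at which the lower bound for the `R`-charge is strict for combinatorial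
reasons. -/
theorem modelCycle_strict (a : Fin 16)
    (ha : ¬((a : ℕ) + 1 = 2 ∨ (a : ℕ) + 1 = 7 ∨ (a : ℕ) + 1 = 13)) :
    ∀ j < (modelCycle a).n, ∃ v ∈ (model a).vertices, 2 ≤ dot ((modelCycle a).u j) v ∨
      (1 ≤ dot ((modelCycle a).u j) v ∧ ∃ i < (modelCycle a).n,
        0 < cross ((modelCycle a).u i - (modelCycle a).u j)
          ((modelCycle a).u (i + 1) - (modelCycle a).u j) ∧
        (-1 < dot ((modelCycle a).u i) v ∨ -1 < dot ((modelCycle a).u (i + 1)) v)) := by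
  change ∀ j < (modelCycle a).n, ∃ v ∈ modelVertices a, _
  revert a; decide +kernel

/-- Models 2, 7 and 13 have a boundary point at which equality holds. -/
theorem modelCycle_sharp (a : Fin 16)
    (ha : (a : ℕ) + 1 = 2 ∨ (a : ℕ) + 1 = 7 ∨ (a : ℕ) + 1 = 13) :
    ∃ j < (modelCycle a).n, ∃ v ∈ (model a).vertices, dot ((modelCycle a).u j) v = 1 ∧
      ∀ i < (modelCycle a).n, cross ((modelCycle a).u i - (modelCycle a).u j)
          ((modelCycle a).u (i + 1) - (modelCycle a).u j) = 0 ∨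
        (dot ((modelCycle a).u i) v = -1 ∧ dot ((modelCycle a).u (i + 1)) v = -1) := by
  change ∃ j < (modelCycle a).n, ∃ v ∈ modelVertices a, _
  revert a; decide +kernel

/-! ### The decomposition of the monoid into unimodular cones -/

/-- The pairing of an element of the monoid with the Reeb vector `(β, 2)`. -/
def reebDegree (Δ : ReflexivePolygon) (β : ℝ × ℝ) : dualMonoid Δ →+ ℝ where
  toFun m := β.1 * m.1.1 + β.2 * m.1.2.1 + 2 * m.1.2.2
  map_zero' := by simp
  map_add' x y := by
    simp only [AddSubmonoid.coe_add, Prod.fst_add, Prod.snd_add]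
    push_cast
    ring

/-- The element `(0, 0, 1)` of the monoid. -/
def apex (Δ : ReflexivePolygon) : dualMonoid Δ := ⟨(0, 0, 1), fun v _ => by simp [pairing]⟩

theorem reebDegree_apex (Δ : ReflexivePolygon) (β : ℝ × ℝ) : reebDegree Δ β (apex Δ) = 2 := by
  simp [reebDegree, apex]

namespace BoundaryCycle

variable {Δ : ReflexivePolygon} (C : BoundaryCycle Δ)

/-- The element `(u i, 1)` of the monoid. -/
def ray (i : Fin C.n) : dualMonoid Δ :=
  ⟨((C.u i).1, (C.u i).2, 1), fun v hv => by
    have := C.mem_polar i i.2 v hv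
    simp only [dot, pairing] at *; linarith⟩

/-- The element `(u (i + 1), 1)` of the monoid. -/
def nextRay (i : Fin C.n) : dualMonoid Δ :=
  ⟨((C.u (i + 1)).1, (C.u (i + 1)).2, 1), fun v hv => by
    have := C.mem_polar_succ i.2 v hv
    simp only [dot, pairing] at *; linarith⟩

theorem exists_ray_eq_nextRay (i : Fin C.n) : ∃ j, C.nextRay i = C.ray j := by
  rcases Nat.lt_or_ge (i + 1) C.n with h | h
  · exact ⟨⟨i + 1, h⟩, rfl⟩
  · have : (i : ℕ) + 1 = C.n := by have := i.2; omega
    refine ⟨⟨0, C.pos⟩, Subtype.ext ?_⟩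
    simp only [nextRay, ray, this, C.closed]

/-- The degree of `(u i, 1)`. -/
def radius (β : ℝ × ℝ) (i : ℕ) : ℝ := 2 + form β (C.u i)

theorem reebDegree_ray (β : ℝ × ℝ) (i : Fin C.n) :
    reebDegree Δ β (C.ray i) = C.radius β i := by
  simp only [reebDegree, ray, radius, form, AddMonoidHom.coe_mk, ZeroHom.coe_mk]
  push_cast; ring

theorem reebDegree_nextRay (β : ℝ × ℝ) (i : Fin C.n) :
    reebDegree Δ β (C.nextRay i) = C.radius β (i + 1) := by
  simp only [reebDegree, nextRay, radius, form, AddMonoidHom.coe_mk, ZeroHom.coe_mk]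
  push_cast; ring

theorem radius_closed (β : ℝ × ℝ) : C.radius β C.n = C.radius β 0 := by
  rw [radius, radius, C.closed]

theorem radius_succ_pos {β : ℝ × ℝ} (h : ∀ i < C.n, 0 < C.radius β i) {i : ℕ} (hi : i < C.n) :
    0 < C.radius β (i + 1) := by
  rcases Nat.lt_or_ge (i + 1) C.n with h' | h'
  · exact h _ h'
  · have : i + 1 = C.n := by omega
    rw [this, C.radius_closed]
    exact h 0 C.pos

/-- The part of the monoid at height zero over the half-open cones. -/
def coneElement : (Unit ⊕ (Σ _ : Fin C.n, ℕ × ℕ)) → dualMonoid Δ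
  | .inl _ => 0
  | .inr ⟨i, a, b⟩ => (a + 1) • C.ray i + b • C.nextRay i

/-- The parametrization of the monoid by the half-open unimodular cones. -/
def decomposition (x : ℕ × (Unit ⊕ (Σ _ : Fin C.n, ℕ × ℕ))) : dualMonoid Δ :=
  x.1 • apex Δ + C.coneElement x.2

theorem cross_coneElement (i : Fin C.n) (a b : ℕ) (w : ℤ × ℤ) :
    cross w (((C.coneElement (.inr ⟨i, a, b⟩)).1.1, (C.coneElement (.inr ⟨i, a, b⟩)).1.2.1))
      = (a + 1) * cross w (C.u i) + b * cross w (C.u (i + 1)) := by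
  simp [coneElement, cross, ray, nextRay]
  ring

theorem dot_coneElement (i : Fin C.n) (a b : ℕ) (w : ℤ × ℤ) :
    dot w (((C.coneElement (.inr ⟨i, a, b⟩)).1.1, (C.coneElement (.inr ⟨i, a, b⟩)).1.2.1))
      = (a + 1) * dot w (C.u i) + b * dot w (C.u (i + 1)) := by
  simp [coneElement, dot, ray, nextRay]
  ring

theorem decomposition_plane (x : ℕ × (Unit ⊕ (Σ _ : Fin C.n, ℕ × ℕ))) :
    (C.decomposition x).1.1 = (C.coneElement x.2).1.1 ∧
      (C.decomposition x).1.2.1 = (C.coneElement x.2).1.2.1 ∧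
      (C.decomposition x).1.2.2 = x.1 + (C.coneElement x.2).1.2.2 := by
  simp [decomposition, apex]

theorem cross_self (u : ℤ × ℤ) : cross u u = 0 := by simp only [cross]; ring

/-- The separating form shows that two equal projections come from the same cone; inside a cone,
pairing by `cross` with the two basis vectors recovers the coefficients. The origin is distinguished
by `key`. -/
theorem coneElement_plane_injective {x y : Unit ⊕ (Σ _ : Fin C.n, ℕ × ℕ)}
    (h1 : (C.coneElement x).1.1 = (C.coneElement y).1.1)
    (h2 : (C.coneElement x).1.2.1 = (C.coneElement y).1.2.1) : x = y := by
  have key : ∀ (i : Fin C.n) (a b : ℕ), cross (C.u (i + 1))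
      (((C.coneElement (.inr ⟨i, a, b⟩)).1.1, (C.coneElement (.inr ⟨i, a, b⟩)).1.2.1)) < 0 := by
    intro i a b
    rw [cross_coneElement, cross_self]
    have := C.unimodular i i.2
    have : cross (C.u (i + 1)) (C.u i) = -1 := by simp only [cross] at *; linarith
    rw [this]
    have : (0 : ℤ) ≤ a := by positivity
    linarith
  rcases x with x | ⟨i, a, b⟩ <;> rcases y with y | ⟨j, a', b'⟩
  · rfl
  · have := key j a' b'
    rw [← h1, ← h2] at this
    simp [coneElement, cross] at this
  · have := key i a b
    rw [h1, h2] at this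
    simp [coneElement, cross] at this
  · have hij : i = j := by
      rcases C.separated i i.2 j j.2 with h | ⟨c, -, h⟩
      · exact Fin.ext h
      · have e1 := C.dot_coneElement i a b c
        have e2 := C.dot_coneElement j a' b' c
        rw [h1, h2, e2] at e1
        exfalso
        have ha : (0 : ℤ) ≤ a := by positivity
        have hb : (0 : ℤ) ≤ b := by positivity
        have ha' : (0 : ℤ) ≤ a' := by positivity
        have hb' : (0 : ℤ) ≤ b' := by positivity
        rcases h with ⟨p1, p2, p3, p4⟩ | ⟨p1, p2, p3, p4⟩
        · nlinarith [mul_nonneg ha p1.le, mul_nonneg hb p2, mul_nonneg ha' (neg_nonneg.2 p3),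
            mul_nonneg hb' (neg_nonneg.2 p4)]
        · nlinarith [mul_nonneg ha' p1.le, mul_nonneg hb' p2, mul_nonneg ha (neg_nonneg.2 p3),
            mul_nonneg hb (neg_nonneg.2 p4)]
    subst hij
    have u1 := C.unimodular i i.2
    have u2 : cross (C.u (i + 1)) (C.u i) = -1 := by simp only [cross] at *; linarith
    have e1 := C.cross_coneElement i a b (C.u i)
    have e2 := C.cross_coneElement i a b (C.u (i + 1))
    rw [h1, h2, cross_coneElement, cross_self, u1] at e1
    rw [h1, h2, cross_coneElement, cross_self, u2] at e2
    have ea : a = a' := by omega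
    have eb : b = b' := by omega
    rw [ea, eb]

theorem decomposition_injective : Function.Injective C.decomposition := by
  rintro ⟨c, x⟩ ⟨c', y⟩ h
  obtain ⟨p1, p2, p3⟩ := C.decomposition_plane (c, x)
  obtain ⟨q1, q2, q3⟩ := C.decomposition_plane (c', y)
  rw [h] at p1 p2 p3
  have hxy : x = y := C.coneElement_plane_injective (p1.symm.trans q1) (p2.symm.trans q2)
  subst hxy
  simp only at p3 q3
  have : c = c' := by omega
  rw [this]

theorem decomposition_surjective : Function.Surjective C.decomposition := by
  rintro ⟨⟨m₁, m₂, m₃⟩, hm⟩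
  by_cases h0 : ((m₁ : ℝ), (m₂ : ℝ)) = 0
  · simp only [Prod.mk_eq_zero, Int.cast_eq_zero] at h0
    obtain ⟨rfl, rfl⟩ := h0
    obtain ⟨v, hv, -⟩ := C.facet 0 C.pos
    have := hm v hv
    simp only [pairing, zero_mul, zero_add] at this
    refine ⟨(m₃.toNat, .inl ()), Subtype.ext ?_⟩
    simp [decomposition, coneElement, apex, this]
  · obtain ⟨i, hi, h1, h2⟩ := C.exists_sector h0
    simp only at h1 h2
    have h1' : 0 ≤ (C.u i).1 * m₂ - (C.u i).2 * m₁ := by exact_mod_cast h1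
    have h2' : (C.u (i + 1)).1 * m₂ - (C.u (i + 1)).2 * m₁ < 0 := by exact_mod_cast h2
    have hu := C.unimodular i hi
    obtain ⟨v, hv, f1, f2⟩ := C.facet i hi
    have hp := hm v hv
    obtain ⟨b, hb⟩ := Int.eq_ofNat_of_zero_le h1'
    -- The coefficient of u i is strictly positive in the half-open cone, and a is that coefficient
    -- minus one.
    obtain ⟨a, ha⟩ := Int.eq_ofNat_of_zero_le
      (show 0 ≤ (C.u (i + 1)).2 * m₁ - (C.u (i + 1)).1 * m₂ - 1 by linarith)
    simp only [cross] at hu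
    have e1 : m₁ = (a + 1) * (C.u i).1 + b * (C.u (i + 1)).1 := by
      rw [← hb, ← ha]; linear_combination (-m₁) * hu
    have e2 : m₂ = (a + 1) * (C.u i).2 + b * (C.u (i + 1)).2 := by
      rw [← hb, ← ha]; linear_combination (-m₂) * hu
    -- Both rays pair to zero with the facet vertex (v, 1), so the condition at v bounds the
    -- multiple of (0, 0, 1) from below by zero.
    have h3 : 0 ≤ m₃ - (a + 1) - b := by
      simp only [pairing, dot] at *
      have : m₁ * v.1 + m₂ * v.2 = -(a + 1) - b := by
        rw [e1, e2]; linear_combination (a + 1 : ℤ) * f1 + (b : ℤ) * f2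
      linarith
    obtain ⟨c, hc⟩ := Int.eq_ofNat_of_zero_le h3
    refine ⟨(c, .inr ⟨⟨i, hi⟩, a, b⟩), Subtype.ext (Prod.ext ?_ (Prod.ext ?_ ?_))⟩ <;>
      simp [decomposition, coneElement, apex, ray, nextRay] <;> linarith

/-! ### The Hilbert series of the monoid -/

theorem rpow_nsmul {t : ℝ} (h0 : 0 < t) (n : ℕ) (x : ℝ) : t ^ (n • x) = (t ^ x) ^ n := by
  rw [nsmul_eq_mul, mul_comm, Real.rpow_mul_natCast h0.le]

theorem hasSum_geometric {t R : ℝ} (h0 : 0 < t) (h1 : t < 1) (hR : 0 < R) :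
    HasSum (fun k : ℕ => (t ^ R) ^ k) (1 - t ^ R)⁻¹ :=
  hasSum_geometric_of_lt_one (Real.rpow_nonneg h0.le _) (Real.rpow_lt_one h0.le h1 hR)

/-- The Hilbert series of the monoid, as a rational function of powers of `t`. -/
noncomputable def series (β : ℝ × ℝ) (t : ℝ) : ℝ :=
  (1 - t ^ (2 : ℝ))⁻¹ * (1 + ∑ i ∈ Finset.range C.n,
    (t ^ C.radius β i * (1 - t ^ C.radius β i)⁻¹) * (1 - t ^ C.radius β (i + 1))⁻¹)

theorem hasSum_mul {ι κ : Type*} {f : ι → ℝ} {g : κ → ℝ} {a b : ℝ} (hf : HasSum f a)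
    (hg : HasSum g b) (hf0 : ∀ i, 0 ≤ f i) (hg0 : ∀ i, 0 ≤ g i) :
    HasSum (fun x : ι × κ => f x.1 * g x.2) (a * b) :=
  hf.mul hg (hf.summable.mul_of_nonneg hg.summable hf0 hg0)

theorem hasSum_series {β : ℝ × ℝ} (hβ : ∀ i < C.n, 0 < C.radius β i) {t : ℝ} (h0 : 0 < t)
    (h1 : t < 1) : HasSum (fun m => t ^ reebDegree Δ β m) (C.series β t) := by
  have hbij : Function.Bijective C.decomposition :=
    ⟨C.decomposition_injective, C.decomposition_surjective⟩
  rw [← (Equiv.ofBijective _ hbij).hasSum_iff]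
  have hpos : ∀ x : ℝ, 0 ≤ t ^ x := fun x => Real.rpow_nonneg h0.le x
  have hcone : ∀ i : Fin C.n, HasSum
      (fun x : ℕ × ℕ => t ^ reebDegree Δ β (C.coneElement (.inr ⟨i, x⟩)))
      ((t ^ C.radius β i * (1 - t ^ C.radius β i)⁻¹) * (1 - t ^ C.radius β (i + 1))⁻¹) := by
    intro i
    have := hasSum_mul ((hasSum_geometric h0 h1 (hβ i i.2)).mul_left (t ^ C.radius β i))
      (hasSum_geometric h0 h1 (C.radius_succ_pos hβ i.2))
      (fun k => mul_nonneg (hpos _) (pow_nonneg (hpos _) _)) (fun k => pow_nonneg (hpos _) _)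
    refine this.congr_fun fun x => ?_
    simp only [coneElement, map_add, map_nsmul, reebDegree_ray, reebDegree_nextRay,
      Real.rpow_add h0, rpow_nsmul h0, pow_succ']
  have hcones : HasSum (fun x => t ^ reebDegree Δ β (C.coneElement x))
      (1 + ∑ i ∈ Finset.range C.n,
        (t ^ C.radius β i * (1 - t ^ C.radius β i)⁻¹) * (1 - t ^ C.radius β (i + 1))⁻¹) := by
    refine HasSum.sum ?_ ?_
    · simp [Function.comp_def, coneElement]
    · rw [← Fin.sum_univ_eq_sum_range (fun i =>
        (t ^ C.radius β i * (1 - t ^ C.radius β i)⁻¹) * (1 - t ^ C.radius β (i + 1))⁻¹)]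
      refine (hasSum_fintype _).sigma_of_hasSum hcone ?_
      exact (summable_sigma_of_nonneg fun _ => hpos _).2
        ⟨fun i => (hcone i).summable, (hasSum_fintype _).summable⟩
  have := hasSum_mul (hasSum_geometric h0 h1 two_pos) hcones
    (fun k => pow_nonneg (hpos _) _) (fun _ => hpos _)
  refine this.congr_fun fun x => ?_
  simp only [Function.comp_apply, Equiv.ofBijective_apply, decomposition, map_add, map_nsmul,
    reebDegree_apex, Real.rpow_add h0, rpow_nsmul h0]

/-! ### The leading coefficients of the Hilbert series -/

/-- Twice the area of the polygon with vertices `u i / R i`; the volume function is proportional to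
it. -/
noncomputable def area (β : ℝ × ℝ) : ℝ :=
  ∑ i ∈ Finset.range C.n, (C.radius β i)⁻¹ * (C.radius β (i + 1))⁻¹

/-- Since t^R / (1 - t^R) = 1 / (1 - t^R) - 1, its constant term is -1 / 2, against +1 / 2 for the
other ray of the cone. The subleading terms (1 / R_i - 1 / R_{i+1}) / 2 telescope around the cycle,
so the second coefficient comes only from the factor 1 / (1 - t^2). In particular A₁ = 2 A₀. -/
theorem hasExpansion_series {β : ℝ × ℝ} (hβ : ∀ i < C.n, 0 < C.radius β i) :
    HasExpansion (fun s => s ^ 3 * C.series β (Real.exp (-s))) (C.area β / 2) (C.area β / 2) := by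
  have hs : ∀ᶠ s : ℝ in 𝓝[>] 0, 0 < s := self_mem_nhdsWithin
  have hterm : ∀ i ∈ Finset.range C.n, HasExpansion
      (fun s => (s * (1 - Real.exp (-s) ^ C.radius β i)⁻¹ + (0 + (-1) * s)) *
        (s * (1 - Real.exp (-s) ^ C.radius β (i + 1))⁻¹))
      ((C.radius β i)⁻¹ * (C.radius β (i + 1))⁻¹)
      ((C.radius β i)⁻¹ / 2 - (C.radius β (i + 1))⁻¹ / 2) := by
    intro i hi
    have hi' := Finset.mem_range.1 hi
    refine (((hasExpansion_geometric (hβ i hi')).add (HasExpansion.affine 0 (-1))).mul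
      (hasExpansion_geometric (C.radius_succ_pos hβ hi'))).of_coeffs ?_ ?_ <;> ring
  have hsum := HasExpansion.sum hterm
  have htel : ∑ i ∈ Finset.range C.n, ((C.radius β i)⁻¹ / 2 - (C.radius β (i + 1))⁻¹ / 2) = 0 := by
    rw [Finset.sum_range_sub' (fun i => (C.radius β i)⁻¹ / 2), C.radius_closed, sub_self]
  rw [htel] at hsum
  -- This is the contribution of the origin, the summand 1 in `series`; it is of negligible order.
  have hsq : HasExpansion (fun s : ℝ => s ^ 2) 0 0 := by
    simpa [HasExpansion] using isBigO_refl (fun s : ℝ => s ^ 2) _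
  refine ((hasExpansion_geometric two_pos).mul (hsq.add hsum)).of_coeffs
    (d₀ := C.area β / 2) (d₁ := C.area β / 2) ?_ ?_ |>.congr' ?_
  · simp only [area]; ring
  · simp only [area]; ring
  · filter_upwards [hs] with s hs
    simp only [series]
    have : ∀ i ∈ Finset.range C.n,
        (s * (1 - Real.exp (-s) ^ C.radius β i)⁻¹ + (0 + (-1) * s)) *
          (s * (1 - Real.exp (-s) ^ C.radius β (i + 1))⁻¹)
        = s ^ 2 * ((Real.exp (-s) ^ C.radius β i * (1 - Real.exp (-s) ^ C.radius β i)⁻¹)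
          * (1 - Real.exp (-s) ^ C.radius β (i + 1))⁻¹) := by
      intro i hi
      have hlt : Real.exp (-s) ^ C.radius β i < 1 :=
        Real.rpow_lt_one (Real.exp_pos _).le (by rw [Real.exp_lt_one_iff]; linarith)
          (hβ i (Finset.mem_range.1 hi))
      have : 1 - Real.exp (-s) ^ C.radius β i ≠ 0 := by linarith
      field_simp
      ring
    rw [Finset.sum_congr rfl this, ← Finset.mul_sum]
    ring

/-! ### The generators -/

theorem exists_decomposition (m : dualMonoid Δ) : (∃ c : ℕ, m = c • apex Δ) ∨
    ∃ (i : Fin C.n) (a b c : ℕ), m = c • apex Δ + ((a + 1) • C.ray i + b • C.nextRay i) := by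
  obtain ⟨⟨c, x | ⟨i, a, b⟩⟩, rfl⟩ := C.decomposition_surjective m
  · exact Or.inl ⟨c, by simp [decomposition, coneElement]⟩
  · exact Or.inr ⟨i, a, b, c, rfl⟩

include C in
theorem height_nonneg (m : dualMonoid Δ) : 0 ≤ m.1.2.2 := by
  rcases C.exists_decomposition m with ⟨c, rfl⟩ | ⟨i, a, b, c, rfl⟩
  · simp [apex]
  · simp [apex, ray, nextRay]
    positivity

include C in
theorem eq_zero_of_height (m : dualMonoid Δ) (h : m.1.2.2 = 0) : m = 0 := by
  rcases C.exists_decomposition m with ⟨c, rfl⟩ | ⟨i, a, b, c, rfl⟩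
  · simp only [apex, AddSubmonoidClass.coe_nsmul] at h
    have : c = 0 := by simpa using h
    simp [this]
  · simp [apex, ray, nextRay] at h
    omega

include C in
theorem irreducible_of_height {m : dualMonoid Δ} (h : m.1.2.2 = 1) :
    m ≠ 0 ∧ ∀ x y : dualMonoid Δ, m = x + y → x = 0 ∨ y = 0 := by
  refine ⟨fun h0 => by simp [h0] at h, fun x y hxy => ?_⟩
  have hx := C.height_nonneg x
  have hy := C.height_nonneg y
  have : x.1.2.2 + y.1.2.2 = 1 := by rw [← h, hxy]; rfl
  rcases (by omega : x.1.2.2 = 0 ∨ y.1.2.2 = 0) with h' | h'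
  · exact Or.inl (C.eq_zero_of_height x h')
  · exact Or.inr (C.eq_zero_of_height y h')

/-- The generator `(0, 0, 1)`. -/
def apexGenerator : Generator Δ := ⟨apex Δ, C.irreducible_of_height rfl⟩

/-- The generator `(u i, 1)`. -/
def rayGenerator (i : Fin C.n) : Generator Δ := ⟨C.ray i, C.irreducible_of_height rfl⟩

/-- An irreducible element has room for only one of the summands in its decomposition. -/
theorem generator_cases (h : Generator Δ) : h.1 = apex Δ ∨ ∃ i, h.1 = C.ray i := by
  obtain ⟨m, hm0, hm⟩ := h
  have hray : ∀ i, C.ray i ≠ 0 := fun i => (C.irreducible_of_height rfl).1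
  have hapex : apex Δ ≠ 0 := (C.irreducible_of_height rfl).1
  rcases C.exists_decomposition m with ⟨c, rfl⟩ | ⟨i, a, b, c, rfl⟩
  · left
    rcases c with _ | c
    · simp at hm0
    · rcases hm _ _ (succ_nsmul _ _) with h | h
      · change (c + 1) • apex Δ = apex Δ
        rw [succ_nsmul, h, zero_add]
      · exact absurd h hapex
  · right
    refine ⟨i, ?_⟩
    have h1 := hm (c • apex Δ + (a • C.ray i + b • C.nextRay i)) (C.ray i) (by
      rw [succ_nsmul]; abel)
    rcases h1 with h1 | h1
    · have : c • apex Δ + ((a + 1) • C.ray i + b • C.nextRay i)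
          = (c • apex Δ + (a • C.ray i + b • C.nextRay i)) + C.ray i := by
        rw [succ_nsmul]; abel
      change c • apex Δ + ((a + 1) • C.ray i + b • C.nextRay i) = C.ray i
      rw [this, h1, zero_add]
    · exact absurd h1 (hray i)

include C in
theorem degreeMap_surjective : Function.Surjective (degreeMap Δ) := by
  intro m
  rcases C.exists_decomposition m with ⟨c, rfl⟩ | ⟨i, a, b, c, rfl⟩
  · exact ⟨Finsupp.single C.apexGenerator c, degreeMap_single _ _ _⟩
  · obtain ⟨j, hj⟩ := C.exists_ray_eq_nextRay i
    refine ⟨Finsupp.single C.apexGenerator c + (Finsupp.single (C.rayGenerator i) (a + 1)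
      + Finsupp.single (C.rayGenerator j) b), ?_⟩
    rw [map_add, map_add, degreeMap_single, degreeMap_single, degreeMap_single, hj]
    rfl

end BoundaryCycle

/-! ### The order of vanishing along a generator -/

/-- The largest `k` such that `m - k h` lies in the monoid. -/
noncomputable def order {Δ : ReflexivePolygon} (h : Generator Δ) (m : dualMonoid Δ) : ℕ :=
  sSup {k | ∃ y, m = k • h.1 + y}

namespace BoundaryCycle

variable {Δ : ReflexivePolygon} (C : BoundaryCycle Δ) (h : Generator Δ)

include C in
theorem height_generator_pos : 1 ≤ h.1.1.2.2 := by
  rcases (C.height_nonneg h.1).eq_or_lt with h0 | h0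
  · exact absurd (C.eq_zero_of_height h.1 h0.symm) h.2.1
  · exact h0

include C in
theorem bddAbove_order (m : dualMonoid Δ) : BddAbove {k : ℕ | ∃ y, m = k • h.1 + y} := by
  refine ⟨m.1.2.2.toNat, ?_⟩
  rintro k ⟨y, rfl⟩
  have h1 := C.height_generator_pos h
  have h2 := C.height_nonneg y
  have h3 : (k • h.1 + y).1.2.2 = k * h.1.1.2.2 + y.1.2.2 := by simp
  rw [h3]
  have : (k : ℤ) * 1 ≤ k * h.1.1.2.2 := mul_le_mul_of_nonneg_left h1 (by positivity)
  omega

include C in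
theorem order_spec (m : dualMonoid Δ) : ∃ y, m = order h m • h.1 + y :=
  Nat.sSup_mem (s := {k : ℕ | ∃ y, m = k • h.1 + y}) ⟨0, m, by simp⟩ (C.bddAbove_order h m)

include C in
theorem le_order (k : ℕ) (y : dualMonoid Δ) : k ≤ order h (k • h.1 + y) :=
  le_csSup (C.bddAbove_order h _) ⟨y, rfl⟩

include C in
-- Subtracting k h is cancellation in the monoid, so the order drops by exactly k.
theorem order_add (k : ℕ) (y : dualMonoid Δ) : order h (k • h.1 + y) = k + order h y := by
  apply le_antisymm
  · obtain ⟨z, hz⟩ := C.order_spec h (k • h.1 + y)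
    obtain ⟨j, hj⟩ := Nat.exists_eq_add_of_le (C.le_order h k y)
    rw [hj, add_nsmul, add_assoc] at hz
    have := C.le_order h j z
    rw [← add_left_cancel hz] at this
    rw [hj]
    exact Nat.add_le_add_left this k
  · obtain ⟨z, hz⟩ := C.order_spec h y
    have := C.le_order h (k + order h y) z
    rwa [add_nsmul, add_assoc, ← hz] at this

include C in
theorem le_order_degreeMap (a : Generator Δ →₀ ℕ) : a h ≤ order h (degreeMap Δ a) := by
  have := C.le_order h (a h) (degreeMap Δ (a.erase h))
  rwa [← degreeMap_single, ← map_add, Finsupp.single_add_erase] at this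

include C in
-- With `le_order_degreeMap` this identifies the order with the largest exponent of x_h over m,
-- which is the input of `mem_centralFibreIdeal_iff`.
theorem exists_degreeMap_order (m : dualMonoid Δ) :
    ∃ a, degreeMap Δ a = m ∧ a h = order h m := by
  obtain ⟨y, hy⟩ := C.order_spec h m
  obtain ⟨a, rfl⟩ := C.degreeMap_surjective y
  have e : degreeMap Δ (Finsupp.single h (order h m) + a) = m := by
    rw [map_add, degreeMap_single, ← hy]
  refine ⟨_, e, le_antisymm ?_ ?_⟩
  · have := C.le_order_degreeMap h (Finsupp.single h (order h m) + a)
    rwa [e] at this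
  · simp

include C in
/-- The monoid is the disjoint union of the translates by multiples of `h` of the elements of
order zero. -/
theorem bijective_order : Function.Bijective
    fun x : ℕ × {y : dualMonoid Δ // order h y = 0} => x.1 • h.1 + x.2.1 := by
  constructor
  · rintro ⟨k, y, hy⟩ ⟨k', y', hy'⟩ e
    simp only at e
    have hk : k = k' := by
      have := congrArg (order h) e
      rwa [C.order_add, C.order_add, hy, hy'] at this
    subst hk
    have := add_left_cancel e
    subst this
    rfl
  · intro m
    obtain ⟨y, hy⟩ := C.order_spec h m
    refine ⟨(order h m, ⟨y, ?_⟩), hy.symm⟩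
    have := congrArg (order h) hy
    rw [C.order_add] at this
    omega

/-- In the decomposition m = k h + y the perturbation changes only the ratio of the geometric series
in k, from t^R to t^(R + ε). -/
theorem hasSum_centralFibre {β : ℝ × ℝ} (hβ : ∀ i < C.n, 0 < C.radius β i) {ε : ℝ}
    (hR : 0 < reebDegree Δ β h.1) (hε : 0 < reebDegree Δ β h.1 + ε) {t : ℝ} (h0 : 0 < t)
    (h1 : t < 1) :
    HasSum (fun m => t ^ (reebDegree Δ β m + ε * order h m))
      ((1 - t ^ (reebDegree Δ β h.1 + ε))⁻¹ *
        ((1 - t ^ reebDegree Δ β h.1) * C.series β t)) := by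
  have hpos : ∀ x : ℝ, 0 ≤ t ^ x := fun x => Real.rpow_nonneg h0.le x
  have hb := C.bijective_order h
  have hT : Summable fun y : {y : dualMonoid Δ // order h y = 0} => t ^ reebDegree Δ β y.1 :=
    (C.hasSum_series hβ h0 h1).summable.comp_injective Subtype.val_injective
  have hmul := fun R (hR : 0 < R) => hasSum_mul (hasSum_geometric h0 h1 hR) hT.hasSum
    (fun k => pow_nonneg (hpos _) _) (fun _ => hpos _)
  have hg : C.series β t = (1 - t ^ reebDegree Δ β h.1)⁻¹ *
      ∑' y : {y : dualMonoid Δ // order h y = 0}, t ^ reebDegree Δ β y.1 := by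
    refine ((Equiv.ofBijective _ hb).hasSum_iff.2 (C.hasSum_series hβ h0 h1)).unique ?_
    refine (hmul _ hR).congr_fun fun x => ?_
    simp only [Function.comp_apply, Equiv.ofBijective_apply, map_add, map_nsmul,
      Real.rpow_add h0, rpow_nsmul h0]
  have hlt := Real.rpow_lt_one h0.le h1 hR
  have hne : 1 - t ^ reebDegree Δ β h.1 ≠ 0 := by linarith
  rw [hg, mul_inv_cancel_left₀ hne, ← (Equiv.ofBijective _ hb).hasSum_iff]
  refine (hmul _ hε).congr_fun fun x => ?_
  simp only [Function.comp_apply, Equiv.ofBijective_apply, map_add, map_nsmul, C.order_add h,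
    x.2.2, add_zero]
  rw [← rpow_nsmul h0, ← Real.rpow_add h0]
  congr 1
  simp only [nsmul_eq_mul]
  ring

end BoundaryCycle

/-! ### Reeb vectors, volumes and Futaki invariants -/

/-- The first two components of the Reeb vector `∑_v b_v (v, 1)`. -/
noncomputable def reebVector (Δ : ReflexivePolygon) (b : Δ.vertices → ℝ) : ℝ × ℝ :=
  (∑ v, b v * v.1.1, ∑ v, b v * v.1.2)

theorem sum_mul_pairing {Δ : ReflexivePolygon} {b : Δ.vertices → ℝ} (hb : ∑ v, b v = 2)
    (m : dualMonoid Δ) : ∑ v : Δ.vertices, b v * (pairing m.1 v.1 : ℝ)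
      = reebDegree Δ (reebVector Δ b) m := by
  simp only [reebDegree, reebVector, pairing, AddMonoidHom.coe_mk, ZeroHom.coe_mk]
  rw [← hb, Finset.sum_mul, Finset.sum_mul, Finset.sum_mul, ← Finset.sum_add_distrib,
    ← Finset.sum_add_distrib]
  refine Finset.sum_congr rfl fun v _ => ?_
  push_cast
  ring

theorem charge_eq {Δ : ReflexivePolygon} {b : Δ.vertices → ℝ} (hb : ∑ v, b v = 2)
    (h : Generator Δ) : charge Δ b h = reebDegree Δ (reebVector Δ b) h.1 :=
  sum_mul_pairing hb h.1

theorem weight_charge {Δ : ReflexivePolygon} {q : Generator Δ → ℝ} {Q : dualMonoid Δ →+ ℝ}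
    (hq : ∀ h, q h = Q h.1) (a : Generator Δ →₀ ℕ) : Finsupp.weight q a = Q (degreeMap Δ a) := by
  induction a using Finsupp.induction_linear with
  | zero => simp
  | add f g hf hg => rw [map_add, map_add, map_add, hf, hg]
  | single i n => rw [degreeMap_single, Finsupp.weight_single, map_nsmul, hq]

theorem weight_add_smul {ι : Type} (q : ι → ℝ) (w : ι → ℕ) (ε : ℝ) (a : ι →₀ ℕ) :
    Finsupp.weight (fun i => q i + ε * (w i : ℝ)) a
      = Finsupp.weight q a + ε * (Finsupp.weight w a : ℕ) := by
  induction a using Finsupp.induction_linear with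
  | zero => simp
  | add f g hf hg => rw [map_add, map_add, map_add, hf, hg]; push_cast; ring
  | single i n =>
    simp only [Finsupp.weight_single, nsmul_eq_mul, smul_eq_mul]
    push_cast
    ring

namespace BoundaryCycle

variable {Δ : ReflexivePolygon} (C : BoundaryCycle Δ)

theorem radius_pos {b : Δ.vertices → ℝ} (hb : IsReeb Δ b) :
    ∀ i < C.n, 0 < C.radius (reebVector Δ b) i := by
  intro i hi
  have h := C.reebDegree_ray (reebVector Δ b) ⟨i, hi⟩
  rw [← h, ← sum_mul_pairing hb.2]
  obtain ⟨v, hv, hpos⟩ := C.interior i hi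
  have hp : ∀ v : ℤ × ℤ, pairing (C.ray ⟨i, hi⟩).1 v = dot (C.u i) v + 1 := by
    intro v; simp [pairing, ray, dot]
  refine Finset.sum_pos' (fun w _ => mul_nonneg (hb.1 w).le ?_) ⟨⟨v, hv⟩, Finset.mem_univ _,
    mul_pos (hb.1 _) ?_⟩
  · have := C.mem_polar i hi w.1 w.2
    rw [hp]
    exact_mod_cast (by linarith : 0 ≤ dot (C.u i) w.1 + 1)
  · rw [hp]
    exact_mod_cast (by linarith : 0 < dot (C.u i) v + 1)

include C in
theorem reebDegree_generator_pos {β : ℝ × ℝ} (hβ : ∀ i < C.n, 0 < C.radius β i)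
    (h : Generator Δ) : 0 < reebDegree Δ β h.1 := by
  rcases C.generator_cases h with e | ⟨i, e⟩
  · rw [e, reebDegree_apex]; exact two_pos
  · rw [e, reebDegree_ray]; exact hβ i i.2

section Fixed

variable {β : ℝ × ℝ} (hβ : ∀ i < C.n, 0 < C.radius β i) {q : Generator Δ → ℝ}
  (hq : ∀ h, q h = reebDegree Δ β h.1)

include hβ in
theorem area_pos : 0 < C.area β := by
  refine Finset.sum_pos (fun i hi => ?_) ⟨0, Finset.mem_range.2 C.pos⟩
  have hi := Finset.mem_range.1 hi
  exact mul_pos (inv_pos.2 (hβ i hi)) (inv_pos.2 (C.radius_succ_pos hβ hi))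

include hβ hq in
theorem hilbertSeries_toricIdeal : HilbertSeriesConverges (toricIdeal Δ) q ∧
    ∀ t : ℝ, 0 < t → t < 1 → hilbertSeries (toricIdeal Δ) q t = C.series β t :=
  hilbertSeries_eq_tsum (mem_toricIdeal_iff Δ)
    (fun m => (C.degreeMap_surjective m).imp fun _ h => ⟨trivial, h⟩)
    (fun a _ => weight_charge hq a) fun _ => C.hasSum_series hβ

include hβ hq in
theorem hasExpansion_toricIdeal : HasExpansion
    (fun s => s ^ 3 * hilbertSeries (toricIdeal Δ) q (Real.exp (-s)))
    (C.area β / 2) (C.area β / 2) := by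
  refine (C.hasExpansion_series hβ).congr' ?_
  filter_upwards [self_mem_nhdsWithin] with s hs
  rw [(C.hilbertSeries_toricIdeal hβ hq).2 _ (Real.exp_pos _)
    (Real.exp_lt_one_iff.2 (neg_neg_of_pos hs))]

include hβ hq in
theorem hilbertSeries_centralFibre (h : Generator Δ) {ε : ℝ} (hε : 0 < q h + ε) :
    HilbertSeriesConverges (centralFibreIdeal (toricIdeal Δ) (testSymmetry Δ h))
        (fun i => q i + ε * (testSymmetry Δ h i : ℝ)) ∧
      ∀ t : ℝ, 0 < t → t < 1 →
        hilbertSeries (centralFibreIdeal (toricIdeal Δ) (testSymmetry Δ h))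
          (fun i => q i + ε * (testSymmetry Δ h i : ℝ)) t
        = (1 - t ^ (q h + ε))⁻¹ * ((1 - t ^ q h) * C.series β t) := by
  refine hilbertSeries_eq_tsum
    (mem_centralFibreIdeal_iff (C.le_order_degreeMap h) (C.exists_degreeMap_order h))
    (fun m => ?_) (Q := fun m => reebDegree Δ β m + ε * order h m) (fun a ha => ?_)
    fun t h0 h1 => ?_
  · obtain ⟨a, rfl, ha⟩ := C.exists_degreeMap_order h m
    exact ⟨a, ha, rfl⟩
  · rw [weight_add_smul, weight_charge hq, weight_testSymmetry, ha]
  · rw [hq] at hε ⊢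
    exact C.hasSum_centralFibre h hβ (C.reebDegree_generator_pos hβ h) hε h0 h1

include hβ hq in
theorem hasExpansion_centralFibre (h : Generator Δ) {ε : ℝ} (hε : 0 < q h + ε) :
    HasExpansion (fun s => s ^ 3 *
        hilbertSeries (centralFibreIdeal (toricIdeal Δ) (testSymmetry Δ h))
          (fun i => q i + ε * (testSymmetry Δ h i : ℝ)) (Real.exp (-s)))
      (2 * (C.area β / 4 * (q h / (q h + ε))))
      (C.area β / 2 * (q h / (q h + ε)) * (1 + ε / 2)) := by
  have e := ((hasExpansion_geometric hε).mul (hasExpansion_one_sub_exp (q h))).mul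
    (C.hasExpansion_series hβ)
  refine (e.of_coeffs ?_ ?_).congr' ?_
  · field_simp; ring
  · field_simp; ring
  · filter_upwards [self_mem_nhdsWithin] with s hs
    rw [(C.hilbertSeries_centralFibre hβ hq h hε).2 _ (Real.exp_pos _)
      (Real.exp_lt_one_iff.2 (neg_neg_of_pos hs))]
    have : s ≠ 0 := ne_of_gt hs
    field_simp

include C hβ hq in
-- On the central fibre A₀(ε) = (area / 4) R / (R + ε) and A₁(ε) / A₀(ε) = 2 + ε, with R = q h. The
-- two derivatives are -area / (4 R) and 1.
theorem isFutakiInvariant_iff (h : Generator Δ) (F : ℝ) :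
    IsFutakiInvariant Δ q (testSymmetry Δ h) F ↔ F = C.area β / 8 - C.area β / (12 * q h) := by
  have hR : 0 < q h := by rw [hq]; exact C.reebDegree_generator_pos hβ h
  have hA := C.area_pos hβ
  have hev : ∀ᶠ ε in 𝓝 (0 : ℝ), 0 < q h + ε := by
    have : Tendsto (fun ε => q h + ε) (𝓝 0) (𝓝 (q h + 0)) :=
      (continuous_const.add continuous_id).tendsto 0
    exact this.eventually (lt_mem_nhds (by linarith))
  have hcf := fun ε (hε : 0 < q h + ε) A₀ A₁ => hasLeadingCoeffs_iff (A₀ := A₀) (A₁ := A₁)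
    (C.hilbertSeries_centralFibre hβ hq h hε).1
  have hto := fun A₀ A₁ => hasLeadingCoeffs_iff (A₀ := A₀) (A₁ := A₁)
    (C.hilbertSeries_toricIdeal hβ hq).1
  have hd : HasDerivAt (fun ε => C.area β / 4 * (q h / (q h + ε))) (-(C.area β / (4 * q h))) 0 := by
    have h1 : HasDerivAt (fun ε => q h + ε) 1 0 := (hasDerivAt_id (0 : ℝ)).const_add _
    have h2 := ((hasDerivAt_const (0 : ℝ) (q h)).fun_div h1 (by simpa using hR.ne')).const_mul
      (C.area β / 4)
    refine h2.congr_deriv ?_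
    simp only [add_zero]
    field_simp
    ring
  have hd' : HasDerivAt (fun ε : ℝ => 2 + ε) 1 0 := (hasDerivAt_id (0 : ℝ)).const_add _
  have hval : C.area β / 8 - C.area β / (12 * q h) = C.area β / 4 / (3 - 1) * 1
      + C.area β / 2 / (3 * (3 - 1) * (C.area β / 4)) * -(C.area β / (4 * q h)) := by
    field_simp
    ring
  constructor
  · rintro ⟨a₀, a₁, A₀, A₁, D, D₀, ha, ha0, hA', hD, hD₀, rfl⟩
    obtain ⟨e0, e1⟩ := ((hto _ _).1 ha).unique (C.hasExpansion_toricIdeal hβ hq)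
    have hAA : ∀ᶠ ε in 𝓝 (0 : ℝ), A₀ ε = C.area β / 4 * (q h / (q h + ε)) ∧
        A₁ ε / A₀ ε = 2 + ε := by
      filter_upwards [hA', hev] with ε hε hε'
      obtain ⟨f0, f1⟩ := ((hcf ε hε' _ _).1 hε.2).unique (C.hasExpansion_centralFibre hβ hq h hε')
      have f0' : A₀ ε = C.area β / 4 * (q h / (q h + ε)) := by linarith
      refine ⟨f0', ?_⟩
      rw [f0', f1]
      field_simp
      ring
    have u0 := hD₀.unique (hd.congr_of_eventuallyEq (hAA.mono fun ε h => h.1))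
    have u1 := hD.unique (hd'.congr_of_eventuallyEq (hAA.mono fun ε h => h.2))
    have e0' : a₀ = C.area β / 4 := by linarith
    rw [hval, u0, u1, e0', e1]
  · intro hF
    refine ⟨C.area β / 4, C.area β / 2, fun ε => C.area β / 4 * (q h / (q h + ε)),
      fun ε => C.area β / 2 * (q h / (q h + ε)) * (1 + ε / 2), 1, -(C.area β / (4 * q h)),
      (hto _ _).2 ((C.hasExpansion_toricIdeal hβ hq).of_coeffs (by ring) rfl), by positivity,
      ?_, ?_, hd, hF.trans hval⟩
    · filter_upwards [hev] with ε hε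
      exact ⟨by positivity, (hcf ε hε _ _).2 (C.hasExpansion_centralFibre hβ hq h hε)⟩
    · refine hd'.congr_of_eventuallyEq ?_
      filter_upwards [hev] with ε hε
      field_simp
      ring

end Fixed

theorem hasVolume_iff {b : Δ.vertices → ℝ} (hb : IsReeb Δ b) (V : ℝ) :
    HasVolume Δ b V ↔ V = 4 / 27 * C.area (reebVector Δ b) := by
  have hβ := C.radius_pos hb
  have hq := charge_eq hb.2
  have ht : Tendsto (fun s : ℝ => 8 / 27 * (s ^ 3 * hilbertSeries (toricIdeal Δ) (charge Δ b)
      (Real.exp (-s)))) (𝓝[>] 0) (𝓝 (4 / 27 * C.area (reebVector Δ b))) := by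
    have := (C.hasExpansion_toricIdeal hβ hq).tendsto.const_mul (8 / 27)
    convert this using 2
    ring
  constructor
  · exact fun h => tendsto_nhds_unique h.2 ht
  · rintro rfl
    exact ⟨(C.hilbertSeries_toricIdeal hβ hq).1, ht⟩

/-! ### Reeb vectors from inequalities -/

theorem radius_eq (β : ℝ × ℝ) (i : ℕ) :
    C.radius β i = 2 + (β.1 * (C.u i).1 + β.2 * (C.u i).2) := rfl

include C in
theorem vertices_nonempty : Δ.vertices.Nonempty := by
  obtain ⟨v, hv, -⟩ := C.facet 0 C.pos
  exact ⟨v, hv⟩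

/-- The polygon is the polar of its dual. -/
theorem half_smul_mem_hull {γ : ℝ × ℝ} (hγ : ∀ i < C.n, 0 ≤ C.radius γ i) :
    (1 / 2 : ℝ) • γ ∈ hull Δ.vertices := by
  by_contra hn
  have hcl : IsClosed (hull Δ.vertices) := (Δ.vertices.finite_toSet.image _).isClosed_convexHull ℝ
  obtain ⟨f, s, hfγ, hfs⟩ := geometric_hahn_banach_point_closed (convex_convexHull ℝ _) hcl hn
  have hf : ∀ x : ℝ × ℝ, f x = f (1, 0) * x.1 + f (0, 1) * x.2 := by
    intro x
    have : x = x.1 • ((1, 0) : ℝ × ℝ) + x.2 • ((0, 1) : ℝ × ℝ) := by ext <;> simp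
    conv_lhs => rw [this]
    simp only [map_add, map_smul, smul_eq_mul]
    ring
  have hv : ∀ v ∈ Δ.vertices, f ((1 / 2 : ℝ) • γ) < f (toPlane v) := fun v hv =>
    hfγ.trans (hfs _ (subset_convexHull ℝ _ ⟨v, by simpa using hv, rfl⟩))
  generalize f (1, 0) = p at hf
  generalize f (0, 1) = q at hf
  simp only [hf, toPlane, Prod.smul_fst, Prod.smul_snd, smul_eq_mul] at hv
  have hne : ((p, q) : ℝ × ℝ) ≠ 0 := by
    intro h
    simp only [Prod.mk_eq_zero] at h
    obtain ⟨v, hv'⟩ := C.vertices_nonempty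
    have := hv v hv'
    rw [h.1, h.2] at this
    simp at this
  -- The separating form (p, q) is a nonnegative combination of u i and u (i + 1). Both equal -1 at
  -- the facet vertex v and are at least -1 at γ / 2, so the form at γ / 2 is not below its value at
  -- v.
  obtain ⟨i, hi, h1, h2⟩ := C.exists_sector hne
  obtain ⟨v, hvΔ, f1, f2⟩ := C.facet i hi
  have hu := C.unimodular i hi
  have hlt := hv v hvΔ
  simp only [dot, cross] at f1 f2 hu h1 h2
  have hu' : ((C.u i).1 : ℝ) * (C.u (i + 1)).2 - (C.u i).2 * (C.u (i + 1)).1 = 1 := by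
    exact_mod_cast hu
  have f1' : ((C.u i).1 : ℝ) * v.1 + (C.u i).2 * v.2 = -1 := by exact_mod_cast f1
  have f2' : ((C.u (i + 1)).1 : ℝ) * v.1 + (C.u (i + 1)).2 * v.2 = -1 := by exact_mod_cast f2
  have r1 := hγ i hi
  have r2 : 0 ≤ C.radius γ (i + 1) := by
    rcases Nat.lt_or_ge (i + 1) C.n with h | h
    · exact hγ _ h
    · have : i + 1 = C.n := by omega
      rw [this, C.radius_closed]
      exact hγ 0 C.pos
  rw [radius_eq] at r1 r2
  generalize ((C.u i).1 : ℝ) = a at *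
  generalize ((C.u i).2 : ℝ) = b at *
  generalize ((C.u (i + 1)).1 : ℝ) = c at *
  generalize ((C.u (i + 1)).2 : ℝ) = d at *
  have e1 : p = (d * p - c * q) * a + (a * q - b * p) * c := by linear_combination (-p) * hu'
  have e2 : q = (d * p - c * q) * b + (a * q - b * p) * d := by linear_combination (-q) * hu'
  have k1 : 0 ≤ d * p - c * q := by linarith
  have e3 : p * v.1 + q * v.2 = -(d * p - c * q) - (a * q - b * p) := by
    linear_combination (d * p - c * q) * f1' + (a * q - b * p) * f2' + v.1 * e1 + v.2 * e2
  have e4 : p * γ.1 + q * γ.2 = (d * p - c * q) * (γ.1 * a + γ.2 * b)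
      + (a * q - b * p) * (γ.1 * c + γ.2 * d) := by
    linear_combination γ.1 * e1 + γ.2 * e2
  have := mul_nonneg k1 r1
  have := mul_nonneg h1 r2
  linarith

theorem exists_weights {γ : ℝ × ℝ} (hγ : ∀ i < C.n, 0 ≤ C.radius γ i) :
    ∃ c : Δ.vertices → ℝ, (∀ v, 0 ≤ c v) ∧ ∑ v, c v = 2 ∧ reebVector Δ c = γ := by
  classical
  have hinj : Function.Injective toPlane := by
    intro v w h
    simp only [toPlane, Prod.mk.injEq, Int.cast_inj] at h
    exact Prod.ext h.1 h.2
  have h := C.half_smul_mem_hull hγ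
  rw [hull, ← Finset.coe_image, Finset.mem_convexHull'] at h
  obtain ⟨w, hw0, hw1, hw2⟩ := h
  rw [Finset.sum_image hinj.injOn, ← Finset.sum_coe_sort] at hw1 hw2
  refine ⟨fun v => 2 * w (toPlane v), fun v => ?_, ?_, ?_⟩
  · exact mul_nonneg two_pos.le (hw0 _ (Finset.mem_image_of_mem _ v.2))
  · rw [← Finset.mul_sum, hw1, mul_one]
  · have e1 := congrArg Prod.fst hw2
    have e2 := congrArg Prod.snd hw2
    simp only [Prod.fst_sum, Prod.snd_sum, Prod.smul_fst, Prod.smul_snd, smul_eq_mul,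
      toPlane] at e1 e2
    refine Prod.ext ?_ ?_
    · simp only [reebVector, mul_assoc, ← Finset.mul_sum]
      simp only [toPlane, e1]
      ring
    · simp only [reebVector, mul_assoc, ← Finset.mul_sum]
      simp only [toPlane, e2]
      ring

/-- Convexity alone gives nonnegative weights. Strict positivity comes from splitting off a small
multiple τ of the Reeb vector of equal weights: for small τ the remainder still satisfies the
inequalities. -/
theorem exists_isReeb {β : ℝ × ℝ} (hβ : ∀ i < C.n, 0 < C.radius β i) :
    ∃ b, IsReeb Δ b ∧ reebVector Δ b = β := by
  have hcard : (0 : ℝ) < Fintype.card Δ.vertices := by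
    have := C.vertices_nonempty.to_subtype
    exact_mod_cast Fintype.card_pos
  set b₀ : Δ.vertices → ℝ := fun _ => 2 / Fintype.card Δ.vertices with hb₀
  have hr : IsReeb Δ b₀ := by
    refine ⟨fun _ => by positivity, ?_⟩
    simp only [hb₀, Finset.sum_const, Finset.card_univ, nsmul_eq_mul]
    field_simp
  have hev : ∀ᶠ τ : ℝ in 𝓝[>] 0, ∀ i ∈ Finset.range C.n,
      τ * C.radius (reebVector Δ b₀) i < C.radius β i := by
    rw [Filter.eventually_all_finset]
    intro i hi
    have : Tendsto (fun τ : ℝ => τ * C.radius (reebVector Δ b₀) i) (𝓝[>] 0)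
        (𝓝 (0 * C.radius (reebVector Δ b₀) i)) :=
      ((continuous_id.mul continuous_const).tendsto 0).mono_left nhdsWithin_le_nhds
    rw [zero_mul] at this
    exact this.eventually (gt_mem_nhds (hβ i (Finset.mem_range.1 hi)))
  have hev1 : ∀ᶠ τ : ℝ in 𝓝[>] 0, τ < 1 := nhdsWithin_le_nhds (gt_mem_nhds one_pos)
  have hev0 : ∀ᶠ τ : ℝ in 𝓝[>] 0, 0 < τ := self_mem_nhdsWithin
  obtain ⟨τ, hτ, hτ1, hτ0⟩ := (hev.and (hev1.and hev0)).exists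
  have h1τ : 0 < 1 - τ := by linarith
  obtain ⟨c, hc0, hc1, hc2⟩ := C.exists_weights
    (γ := (1 - τ)⁻¹ • (β - τ • reebVector Δ b₀)) (by
      intro i hi
      have := hτ i (Finset.mem_range.2 hi)
      have e : C.radius ((1 - τ)⁻¹ • (β - τ • reebVector Δ b₀)) i
          = (1 - τ)⁻¹ * (C.radius β i - τ * C.radius (reebVector Δ b₀) i) := by
        simp only [radius_eq, Prod.smul_fst, Prod.smul_snd, Prod.fst_sub, Prod.snd_sub,
          smul_eq_mul]
        field_simp
        ring
      rw [e]
      exact mul_nonneg (inv_pos.2 h1τ).le (by linarith))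
  refine ⟨fun v => τ * b₀ v + (1 - τ) * c v, ⟨fun v => ?_, ?_⟩, ?_⟩
  · have := mul_pos hτ0 (hr.1 v)
    have := mul_nonneg h1τ.le (hc0 v)
    linarith
  · rw [Finset.sum_add_distrib, ← Finset.mul_sum, ← Finset.mul_sum, hr.2, hc1]
    ring
  · have e : reebVector Δ (fun v => τ * b₀ v + (1 - τ) * c v)
        = τ • reebVector Δ b₀ + (1 - τ) • reebVector Δ c := by
      refine Prod.ext ?_ ?_ <;>
      · simp only [reebVector, Prod.fst_add, Prod.snd_add, Prod.smul_fst, Prod.smul_snd,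
          smul_eq_mul, Finset.mul_sum, ← Finset.sum_add_distrib]
        exact Finset.sum_congr rfl fun v _ => by ring
    rw [e, hc2, smul_inv_smul₀ h1τ.ne']
    abel

/-! ### Existence of the volume minimum -/

theorem continuous_radius (i : ℕ) : Continuous fun β => C.radius β i := by
  simp only [radius_eq]
  fun_prop

theorem isCompact_radius_ge {δ : ℝ} (hδ : 0 ≤ δ) :
    IsCompact {γ : ℝ × ℝ | ∀ i < C.n, δ ≤ C.radius γ i} := by
  have hK : IsCompact ((fun x : ℝ × ℝ => (2 : ℝ) • x) '' hull Δ.vertices) :=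
    ((Δ.vertices.finite_toSet.image _).isCompact_convexHull ℝ).image (continuous_const_smul _)
  refine hK.of_isClosed_subset ?_ fun γ hγ => ?_
  · simp only [Set.ofPred_forall]
    exact isClosed_iInter fun i => isClosed_iInter fun _ =>
      isClosed_le continuous_const (C.continuous_radius i)
  · refine ⟨_, C.half_smul_mem_hull fun i hi => hδ.trans (hγ i hi), ?_⟩
    simp [smul_smul]

/-- The area blows up at the boundary. All radii are at most M by compactness, so a small radius R_i
makes the single term 1 / (R_i R_{i+1}) exceed the area at β = 0. The relevant sublevel set lies in
a compact set where the area is continuous. -/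
theorem exists_area_min : ∃ β, (∀ i < C.n, 0 < C.radius β i) ∧
    ∀ γ, (∀ i < C.n, 0 < C.radius γ i) → C.area β ≤ C.area γ := by
  have hr0 : ∀ i, C.radius 0 i = 2 := fun i => by simp [radius_eq]
  have hW : 0 < C.area 0 := C.area_pos fun i _ => by rw [hr0]; exact two_pos
  obtain ⟨M, hM⟩ := (C.isCompact_radius_ge le_rfl).exists_bound_of_continuousOn
    (f := fun γ => ∑ i ∈ Finset.range (C.n + 1), C.radius γ i)
    (continuous_finsetSum _ fun i _ => C.continuous_radius i).continuousOn
  have hbound : ∀ γ, (∀ i < C.n, 0 < C.radius γ i) → ∀ i ≤ C.n, C.radius γ i ≤ M := by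
    intro γ hγ i hi
    have hpos : ∀ k ∈ Finset.range (C.n + 1), 0 ≤ C.radius γ k := by
      intro k hk
      rcases (Nat.lt_succ_iff.1 (Finset.mem_range.1 hk)).lt_or_eq with h | h
      · exact (hγ k h).le
      · rw [h, C.radius_closed]; exact (hγ 0 C.pos).le
    exact (Finset.single_le_sum hpos (Finset.mem_range.2 (by omega))).trans
      ((le_abs_self _).trans (hM γ fun i hi => (hγ i hi).le))
  have hM0 : 0 < M := by
    have := hbound 0 (fun i _ => by rw [hr0]; exact two_pos) 0 (Nat.zero_le _)
    rw [hr0] at this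
    linarith
  -- The bound 2 keeps β = 0, where all radii are 2, in the compact set.
  set δ := min 2 (C.area 0 * M)⁻¹ with hδ
  have hδ0 : 0 < δ := lt_min two_pos (by positivity)
  have hlow : ∀ γ, (∀ i < C.n, 0 < C.radius γ i) → C.area γ ≤ C.area 0 →
      ∀ i < C.n, δ ≤ C.radius γ i := by
    intro γ hγ hle i hi
    refine (min_le_right _ _).trans ?_
    have h1 := hγ i hi
    have h2 := C.radius_succ_pos hγ hi
    have h3 : (C.radius γ i)⁻¹ * (C.radius γ (i + 1))⁻¹ ≤ C.area γ :=
      Finset.single_le_sum (f := fun i => (C.radius γ i)⁻¹ * (C.radius γ (i + 1))⁻¹)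
        (fun k hk => mul_nonneg (inv_pos.2 (hγ k (Finset.mem_range.1 hk))).le
          (inv_pos.2 (C.radius_succ_pos hγ (Finset.mem_range.1 hk))).le) (Finset.mem_range.2 hi)
    have h4 := hbound γ hγ (i + 1) hi
    have h5 := h3.trans hle
    rw [← mul_inv, inv_le_comm₀ (by positivity) hW] at h5
    rw [mul_inv, ← div_eq_mul_inv, div_le_iff₀ hM0]
    exact h5.trans (mul_le_mul_of_nonneg_left h4 h1.le)
  have hcont : ContinuousOn C.area {γ : ℝ × ℝ | ∀ i < C.n, δ ≤ C.radius γ i} := by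
    refine continuousOn_finsetSum _ fun i hi => ?_
    have hi := Finset.mem_range.1 hi
    refine ((C.continuous_radius i).continuousOn.inv₀ fun γ hγ => ?_).mul
      ((C.continuous_radius (i + 1)).continuousOn.inv₀ fun γ hγ => ?_)
    · exact (hδ0.trans_le (hγ i hi)).ne'
    · exact (C.radius_succ_pos (fun k hk => hδ0.trans_le (hγ k hk)) hi).ne'
  have h0mem : (0 : ℝ × ℝ) ∈ {γ : ℝ × ℝ | ∀ i < C.n, δ ≤ C.radius γ i} := fun i _ => by
    rw [hr0]; exact min_le_left _ _
  obtain ⟨β, hβ, hmin⟩ := (C.isCompact_radius_ge hδ0.le).exists_isMinOn ⟨0, h0mem⟩ hcont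
  refine ⟨β, fun i hi => hδ0.trans_le (hβ i hi), fun γ hγ => ?_⟩
  rcases le_total (C.area γ) (C.area 0) with h | h
  · exact hmin (hlow γ hγ h)
  · exact (hmin h0mem).trans h

/-! ### The minimum is a critical point -/

/-- The sum is minus the derivative of the area in direction d. It is also three times the sum, over
the triangles from the origin to the edges of the polygon with vertices u i / R i, of twice the area
times the value of d at the centroid. So the barycentre is the origin. -/
theorem critical {β : ℝ × ℝ} (hβ : ∀ i < C.n, 0 < C.radius β i)
    (hmin : ∀ γ, (∀ i < C.n, 0 < C.radius γ i) → C.area β ≤ C.area γ) (d : ℝ × ℝ) :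
    ∑ i ∈ Finset.range C.n, (C.radius β i)⁻¹ * (C.radius β (i + 1))⁻¹ *
      (form d (C.u i) / C.radius β i + form d (C.u (i + 1)) / C.radius β (i + 1)) = 0 := by
  have hrad : ∀ i τ, C.radius (β + τ • d) i = C.radius β i + τ * form d (C.u i) := by
    intro i τ
    simp only [radius_eq, form, Prod.fst_add, Prod.snd_add, Prod.smul_fst, Prod.smul_snd,
      smul_eq_mul]
    ring
  have hder : ∀ i, HasDerivAt (fun τ : ℝ => C.radius (β + τ • d) i) (form d (C.u i)) 0 := by
    intro i
    simp only [hrad]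
    simpa using ((hasDerivAt_id (0 : ℝ)).mul_const (form d (C.u i))).const_add (C.radius β i)
  have hz : ∀ i, C.radius (β + (0 : ℝ) • d) i = C.radius β i := fun i => by simp
  have hA : HasDerivAt (fun τ : ℝ => C.area (β + τ • d)) (∑ i ∈ Finset.range C.n,
      -((C.radius β i)⁻¹ * (C.radius β (i + 1))⁻¹ *
      (form d (C.u i) / C.radius β i + form d (C.u (i + 1)) / C.radius β (i + 1)))) 0 := by
    refine HasDerivAt.fun_sum fun i hi => ?_
    have hi := Finset.mem_range.1 hi
    have p1 := (hβ i hi).ne'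
    have p2 := (C.radius_succ_pos hβ hi).ne'
    refine (((hder i).fun_inv (by rwa [hz])).fun_mul
      ((hder (i + 1)).fun_inv (by rwa [hz]))).congr_deriv ?_
    rw [hz, hz]
    field_simp
    ring
  have hev : ∀ᶠ τ : ℝ in 𝓝 0, ∀ i ∈ Finset.range C.n, 0 < C.radius (β + τ • d) i := by
    rw [Filter.eventually_all_finset]
    intro i hi
    have := (hder i).continuousAt.tendsto
    refine this.eventually (lt_mem_nhds ?_)
    rw [hz]
    exact hβ i (Finset.mem_range.1 hi)
  have hloc : IsLocalMin (fun τ : ℝ => C.area (β + τ • d)) 0 := by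
    filter_upwards [hev] with τ hτ
    rw [zero_smul, add_zero]
    exact hmin _ fun i hi => hτ i (Finset.mem_range.2 hi)
  have := hloc.hasDerivAt_eq_zero hA
  rwa [Finset.sum_neg_distrib, neg_eq_zero] at this

/-! ### The lower bound for the degrees of the generators -/

/-- Moving the apex of a triangle over an edge from the origin to u j / R j changes its contribution
by those of two triangles that join the origin and u j / R j to the ends of the edge. These are the
terms in e and e', which telescope along the cycle. -/
theorem triangle_identity {R R' S l l' L e e' D : ℝ} (hR : 0 < R) (hR' : 0 < R')
    (hD : D = 1 + e - e') (hS : S = e' * R - e * R' + 2 * D) (hL : L = e' * l - e * l' + D) :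
    D * (R⁻¹ * R'⁻¹ * (l / R + l' / R'))
      = S / 2 * (R⁻¹ * R'⁻¹ * (1 / 2 + (l / R + l' / R'))) - L / 2 * (R⁻¹ * R'⁻¹)
        + (e / R * (1 / 2 + l / R) / 2 - e' / R' * (1 / 2 + l' / R') / 2) := by
  subst hS hL hD
  field_simp
  ring

/-- Computing the barycentre of the polygon with vertices `u i / R i` from the triangulation with
apex `u j / R j`. -/
theorem barycentre_identity {β : ℝ × ℝ} (hβ : ∀ i < C.n, 0 < C.radius β i)
    (hmin : ∀ γ, (∀ i < C.n, 0 < C.radius γ i) → C.area β ≤ C.area γ) (j : ℕ) (v : ℤ × ℤ) :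
    ∑ i ∈ Finset.range C.n, (cross (C.u i - C.u j) (C.u (i + 1) - C.u j) : ℝ) *
      ((C.radius β i)⁻¹ * (C.radius β (i + 1))⁻¹ * (((dot (C.u i) v + 1 : ℤ) : ℝ) / C.radius β i
        + ((dot (C.u (i + 1)) v + 1 : ℤ) : ℝ) / C.radius β (i + 1)))
      = C.area β * (3 / 4 * C.radius β j - ((dot (C.u j) v + 1 : ℤ) : ℝ) / 2) := by
  set w : ℕ → ℝ := fun i => (C.radius β i)⁻¹ * (C.radius β (i + 1))⁻¹ with hw
  set l : ℕ → ℝ := fun i => ((dot (C.u i) v + 1 : ℤ) : ℝ) with hl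
  set R : ℕ → ℝ := C.radius β with hRdef
  have hcrit : ∑ i ∈ Finset.range C.n, w i * (l i / R i + l (i + 1) / R (i + 1)) = C.area β := by
    -- The direction 2 v - β takes the value 2 l i - R i at u i. Criticality then says that the
    -- affine function of v has value 1 / 2 at the barycentre.
    have h := C.critical hβ hmin (2 * (v.1 : ℝ) - β.1, 2 * (v.2 : ℝ) - β.2)
    have hf : ∀ i, form (2 * (v.1 : ℝ) - β.1, 2 * (v.2 : ℝ) - β.2) (C.u i) = 2 * l i - R i := by
      intro i
      simp only [form, hl, hRdef, radius_eq, dot]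
      push_cast
      ring
    have h' : ∑ i ∈ Finset.range C.n, (2 * (w i * (l i / R i + l (i + 1) / R (i + 1)))
        - 2 * w i) = 0 := by
      rw [← h]
      refine Finset.sum_congr rfl fun i hi => ?_
      have hi := Finset.mem_range.1 hi
      have p1 : 0 < R i := hβ i hi
      have p2 : 0 < R (i + 1) := C.radius_succ_pos hβ hi
      rw [hf, hf, ← hRdef]
      simp only [hw]
      field_simp
      ring
    rw [Finset.sum_sub_distrib, ← Finset.mul_sum, ← Finset.mul_sum] at h'
    have : C.area β = ∑ i ∈ Finset.range C.n, w i := rfl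
    linarith
  set e : ℕ → ℝ := fun i => (cross (C.u j) (C.u i) : ℝ) with he
  have hterm : ∀ i ∈ Finset.range C.n,
      (cross (C.u i - C.u j) (C.u (i + 1) - C.u j) : ℝ) *
        (w i * (l i / R i + l (i + 1) / R (i + 1)))
      = R j / 2 * (w i * (1 / 2 + (l i / R i + l (i + 1) / R (i + 1)))) - l j / 2 * w i
        + (e i / R i * (1 / 2 + l i / R i) / 2
          - e (i + 1) / R (i + 1) * (1 / 2 + l (i + 1) / R (i + 1)) / 2) := by
    intro i hi
    have hi := Finset.mem_range.1 hi
    have hu := C.unimodular i hi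
    have hu' : ((C.u i).1 : ℝ) * (C.u (i + 1)).2 - (C.u i).2 * (C.u (i + 1)).1 = 1 := by
      simp only [cross] at hu
      exact_mod_cast hu
    have hD : (cross (C.u i - C.u j) (C.u (i + 1) - C.u j) : ℝ) = 1 + e i - e (i + 1) := by
      simp only [he, cross, Prod.fst_sub, Prod.snd_sub]
      push_cast
      linear_combination hu'
    refine triangle_identity (hβ i hi) (C.radius_succ_pos hβ hi) hD ?_ ?_
    · rw [hD]
      have h := eq_combination hu β (C.u j)
      have c1 : cross (C.u i) (C.u j) = -cross (C.u j) (C.u i) := by simp only [cross]; ring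
      rw [c1] at h
      simp only [hRdef, radius, he]
      rw [h]
      push_cast
      ring
    · rw [hD]
      have h := eq_combination hu ((v.1 : ℝ), (v.2 : ℝ)) (C.u j)
      have c1 : cross (C.u i) (C.u j) = -cross (C.u j) (C.u i) := by simp only [cross]; ring
      rw [c1] at h
      have hf : ∀ i, l i = form ((v.1 : ℝ), (v.2 : ℝ)) (C.u i) + 1 := by
        intro i
        simp only [hl, form, dot]
        push_cast
        ring
      rw [hf, hf, hf, h]
      simp only [he]
      push_cast
      ring
  have htel := Finset.sum_range_sub' (fun i => e i / R i * (1 / 2 + l i / R i) / 2) C.n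
  have hcl : e C.n / R C.n * (1 / 2 + l C.n / R C.n) / 2
      = e 0 / R 0 * (1 / 2 + l 0 / R 0) / 2 := by
    simp only [he, hl, hRdef, C.radius_closed, C.closed]
  rw [hcl, sub_self] at htel
  have hsum : ∑ i ∈ Finset.range C.n, w i * (1 / 2 + (l i / R i + l (i + 1) / R (i + 1)))
      = 3 / 2 * C.area β := by
    rw [Finset.sum_congr rfl fun i _ => mul_add (w i) (1 / 2) _, Finset.sum_add_distrib, hcrit,
      ← Finset.sum_mul]
    change C.area β * (1 / 2) + C.area β = _
    ring
  rw [Finset.sum_congr rfl hterm, Finset.sum_add_distrib, Finset.sum_sub_distrib, htel,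
    ← Finset.mul_sum, ← Finset.mul_sum, hsum]
  change R j / 2 * (3 / 2 * C.area β) - l j / 2 * C.area β + 0
    = C.area β * (3 / 4 * R j - l j / 2)
  ring

section Minimum

variable {β : ℝ × ℝ} (hβ : ∀ i < C.n, 0 < C.radius β i)
  (hmin : ∀ γ, (∀ i < C.n, 0 < C.radius γ i) → C.area β ≤ C.area γ)

include hβ in
theorem triangle_nonneg {i j : ℕ} (hi : i < C.n) (hj : j < C.n) {v : ℤ × ℤ}
    (hv : v ∈ Δ.vertices) :
    0 ≤ (cross (C.u i - C.u j) (C.u (i + 1) - C.u j) : ℝ) *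
      ((C.radius β i)⁻¹ * (C.radius β (i + 1))⁻¹ * (((dot (C.u i) v + 1 : ℤ) : ℝ) / C.radius β i
        + ((dot (C.u (i + 1)) v + 1 : ℤ) : ℝ) / C.radius β (i + 1))) := by
  have h1 := hβ i hi
  have h2 := C.radius_succ_pos hβ hi
  have h3 : (0 : ℝ) ≤ (dot (C.u i) v + 1 : ℤ) := by
    have := C.mem_polar i hi v hv
    exact_mod_cast (by linarith : 0 ≤ dot (C.u i) v + 1)
  have h4 : (0 : ℝ) ≤ (dot (C.u (i + 1)) v + 1 : ℤ) := by
    have := C.mem_polar_succ hi v hv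
    exact_mod_cast (by linarith : 0 ≤ dot (C.u (i + 1)) v + 1)
  have h5 : (0 : ℝ) ≤ cross (C.u i - C.u j) (C.u (i + 1) - C.u j) := by
    exact_mod_cast C.convex j hj i hi
  positivity

include hβ hmin in
-- Every term of `barycentre_identity` is nonnegative: the first factor by convexity of the cycle,
-- the others because the cycle lies in the dual polygon.
theorem dot_add_one_le {j : ℕ} (hj : j < C.n) {v : ℤ × ℤ} (hv : v ∈ Δ.vertices) :
    2 / 3 * ((dot (C.u j) v : ℝ) + 1) ≤ C.radius β j := by
  have h := C.barycentre_identity hβ hmin j v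
  have h0 := Finset.sum_nonneg fun i hi =>
    C.triangle_nonneg hβ (Finset.mem_range.1 hi) hj hv
  rw [h] at h0
  have := nonneg_of_mul_nonneg_right h0 (C.area_pos hβ)
  push_cast at this
  linarith

include hβ hmin in
theorem dot_add_one_lt {i j : ℕ} (hi : i < C.n) (hj : j < C.n) {v : ℤ × ℤ}
    (hv : v ∈ Δ.vertices) (hD : 0 < cross (C.u i - C.u j) (C.u (i + 1) - C.u j))
    (hl : -1 < dot (C.u i) v ∨ -1 < dot (C.u (i + 1)) v) :
    2 / 3 * ((dot (C.u j) v : ℝ) + 1) < C.radius β j := by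
  have h := C.barycentre_identity hβ hmin j v
  have h0 := Finset.sum_pos' (fun i hi => C.triangle_nonneg hβ (Finset.mem_range.1 hi) hj hv)
    ⟨i, Finset.mem_range.2 hi, by
    have h1 := hβ i hi
    have h2 := C.radius_succ_pos hβ hi
    have h3 : (0 : ℝ) ≤ (dot (C.u i) v + 1 : ℤ) := by
      have := C.mem_polar i hi v hv
      exact_mod_cast (by linarith : 0 ≤ dot (C.u i) v + 1)
    have h4 : (0 : ℝ) ≤ (dot (C.u (i + 1)) v + 1 : ℤ) := by
      have := C.mem_polar_succ hi v hv
      exact_mod_cast (by linarith : 0 ≤ dot (C.u (i + 1)) v + 1)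
    have h5 : (0 : ℝ) < cross (C.u i - C.u j) (C.u (i + 1) - C.u j) := by exact_mod_cast hD
    rcases hl with hl | hl
    · have h6 : (0 : ℝ) < (dot (C.u i) v + 1 : ℤ) := by
        exact_mod_cast (by linarith : 0 < dot (C.u i) v + 1)
      positivity
    · have h6 : (0 : ℝ) < (dot (C.u (i + 1)) v + 1 : ℤ) := by
        exact_mod_cast (by linarith : 0 < dot (C.u (i + 1)) v + 1)
      positivity⟩
  rw [h] at h0
  have := pos_of_mul_pos_right h0 (C.area_pos hβ).le
  push_cast at this
  linarith

include hβ hmin in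
-- The hypothesis describes a triangle with apex u j whose opposite side lies where the affine
-- function of v vanishes; every term of `barycentre_identity` is then zero.
theorem radius_eq_of_triangle {j : ℕ} {v : ℤ × ℤ}
    (h0 : ∀ i < C.n, cross (C.u i - C.u j) (C.u (i + 1) - C.u j) = 0 ∨
      (dot (C.u i) v = -1 ∧ dot (C.u (i + 1)) v = -1)) :
    C.radius β j = 2 / 3 * ((dot (C.u j) v : ℝ) + 1) := by
  have h := C.barycentre_identity hβ hmin j v
  rw [Finset.sum_eq_zero] at h
  · have := (mul_eq_zero.1 h.symm).resolve_left (C.area_pos hβ).ne'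
    push_cast at this
    linarith
  · intro i hi
    rcases h0 i (Finset.mem_range.1 hi) with e | ⟨e1, e2⟩
    · rw [e]; simp
    · rw [e1, e2]; simp

include hβ hmin in
theorem four_thirds_le (h : Generator Δ) : 4 / 3 ≤ reebDegree Δ β h.1 := by
  rcases C.generator_cases h with e | ⟨i, e⟩
  · rw [e, reebDegree_apex]; norm_num
  · rw [e, reebDegree_ray]
    obtain ⟨v, hv, hd⟩ := C.interior i i.2
    have h1 := C.dot_add_one_le hβ hmin i.2 hv
    have h2 : (1 : ℝ) ≤ dot (C.u i) v := by exact_mod_cast hd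
    linarith

end Minimum

/-! ### Volume minimizers and the final inequality -/

include C in
theorem exists_isVolumeMinimum : ∃ b V, IsVolumeMinimum Δ b V := by
  obtain ⟨β, hβ, hmin⟩ := C.exists_area_min
  obtain ⟨b, hb, rfl⟩ := C.exists_isReeb hβ
  refine ⟨b, _, hb, (C.hasVolume_iff hb _).2 rfl, fun b' hb' =>
    ⟨_, (C.hasVolume_iff hb' _).2 rfl, ?_⟩⟩
  have := hmin _ (C.radius_pos hb')
  linarith

/-- The volume depends on b only through its Reeb vector, and `exists_isReeb` realizes every
admissible planar vector. Minimality among the b, which need not be unique, thus becomes minimality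
of the area in the plane. -/
theorem area_le_of_isVolumeMinimum {b : Δ.vertices → ℝ} {V : ℝ} (h : IsVolumeMinimum Δ b V) :
    V = 4 / 27 * C.area (reebVector Δ b) ∧
      ∀ γ, (∀ i < C.n, 0 < C.radius γ i) → C.area (reebVector Δ b) ≤ C.area γ := by
  obtain ⟨hb, hV, hle⟩ := h
  have hV' := (C.hasVolume_iff hb V).1 hV
  refine ⟨hV', fun γ hγ => ?_⟩
  obtain ⟨b', hb', rfl⟩ := C.exists_isReeb hγ
  obtain ⟨V', hV'', hVV'⟩ := hle b' hb'
  rw [C.hasVolume_iff hb'] at hV''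
  linarith

include C in
theorem exists_futakiInvariant {b : Δ.vertices → ℝ} {V : ℝ} (hb : IsVolumeMinimum Δ b V)
    (h : Generator Δ) : ∃ F : ℝ,
      IsFutakiInvariant Δ (charge Δ b) (testSymmetry Δ h) F ∧
      (∀ F', IsFutakiInvariant Δ (charge Δ b) (testSymmetry Δ h) F' → F' = F) ∧
      27 / 64 * V ≤ F ∧ (F = 27 / 64 * V ↔ charge Δ b h = 4 / 3) := by
  obtain ⟨hV, hmin⟩ := C.area_le_of_isVolumeMinimum hb
  have hβ := C.radius_pos hb.1
  have hF := C.isFutakiInvariant_iff hβ (charge_eq hb.1.2) h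
  have hR := C.four_thirds_le hβ hmin h
  rw [← charge_eq hb.1.2] at hR
  have hA := C.area_pos hβ
  have hR0 : 0 < charge Δ b h := by linarith
  -- Here (27 / 64) V = area / 16, and the threshold 4 / 3 is the root of 1 / 16 = 1 / (12 R).
  have e : C.area (reebVector Δ b) / 8 - C.area (reebVector Δ b) / (12 * charge Δ b h)
      - 27 / 64 * V
      = C.area (reebVector Δ b) / (16 * charge Δ b h) * (charge Δ b h - 4 / 3) := by
    rw [hV]
    field_simp
    ring
  have hpos : 0 < C.area (reebVector Δ b) / (16 * charge Δ b h) := by positivity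
  refine ⟨_, (hF _).2 rfl, fun F' => (hF F').1, ?_, ?_⟩
  · have := mul_nonneg hpos.le (sub_nonneg.2 hR)
    linarith
  · rw [← sub_eq_zero, e, mul_eq_zero, sub_eq_zero]
    exact ⟨fun h => h.resolve_left hpos.ne', Or.inr⟩

end BoundaryCycle

theorem exists_charge_eq_iff (a : Fin 16) {b : (model a).vertices → ℝ} {V : ℝ}
    (hb : IsVolumeMinimum (model a) b V) :
    (∃ h, charge (model a) b h = 4 / 3) ↔
      (a : ℕ) + 1 = 2 ∨ (a : ℕ) + 1 = 7 ∨ (a : ℕ) + 1 = 13 := by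
  obtain ⟨-, hmin⟩ := (modelCycle a).area_le_of_isVolumeMinimum hb
  have hβ := (modelCycle a).radius_pos hb.1
  constructor
  · rintro ⟨h, hh⟩
    by_contra hne
    rw [charge_eq hb.1.2] at hh
    rcases (modelCycle a).generator_cases h with e | ⟨j, e⟩
    · rw [e, reebDegree_apex] at hh
      norm_num at hh
    · rw [e, BoundaryCycle.reebDegree_ray] at hh
      -- Either a vertex with dot product at least 2 forces R ≥ 2, or a nondegenerate triangle not
      -- contained in the zero set makes R > 4 / 3.
      obtain ⟨v, hv, h2 | ⟨h1, i, hi, hD, hl⟩⟩ := modelCycle_strict a hne j j.2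
      · have := (modelCycle a).dot_add_one_le hβ hmin j.2 hv
        have h2' : (2 : ℝ) ≤ dot ((modelCycle a).u j) v := by exact_mod_cast h2
        linarith
      · have := (modelCycle a).dot_add_one_lt hβ hmin hi j.2 hv hD hl
        have h1' : (1 : ℝ) ≤ dot ((modelCycle a).u j) v := by exact_mod_cast h1
        linarith
  · intro ha
    obtain ⟨j, hj, v, -, h1, h0⟩ := modelCycle_sharp a ha
    refine ⟨(modelCycle a).rayGenerator ⟨j, hj⟩, ?_⟩
    rw [charge_eq hb.1.2]
    have e := (modelCycle a).reebDegree_ray (reebVector (model a) b) ⟨j, hj⟩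
    have := (modelCycle a).radius_eq_of_triangle hβ hmin h0
    rw [h1] at this
    refine e.trans (this.trans ?_)
    norm_num

end FutakiReflexive

theorem mainTheorem4 (a : Fin 16) :
    (∃ (b : (FutakiReflexive.model a).vertices → ℝ) (Vmin : ℝ),
      FutakiReflexive.IsVolumeMinimum (FutakiReflexive.model a) b Vmin) ∧
    ∀ (b : (FutakiReflexive.model a).vertices → ℝ) (Vmin : ℝ),
      FutakiReflexive.IsVolumeMinimum (FutakiReflexive.model a) b Vmin →
      (∀ h : FutakiReflexive.Generator (FutakiReflexive.model a),
        ∃ F : ℝ,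
          FutakiReflexive.IsFutakiInvariant (FutakiReflexive.model a)
            (FutakiReflexive.charge (FutakiReflexive.model a) b)
            (FutakiReflexive.testSymmetry (FutakiReflexive.model a) h) F ∧
          (∀ F' : ℝ, FutakiReflexive.IsFutakiInvariant (FutakiReflexive.model a)
            (FutakiReflexive.charge (FutakiReflexive.model a) b)
            (FutakiReflexive.testSymmetry (FutakiReflexive.model a) h) F' → F' = F) ∧
          27 / 64 * Vmin ≤ F ∧
          (F = 27 / 64 * Vmin ↔
            FutakiReflexive.charge (FutakiReflexive.model a) b h = 4 / 3)) ∧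
      ((∃ h : FutakiReflexive.Generator (FutakiReflexive.model a),
          FutakiReflexive.charge (FutakiReflexive.model a) b h = 4 / 3) ↔
        (a : ℕ) + 1 = 2 ∨ (a : ℕ) + 1 = 7 ∨ (a : ℕ) + 1 = 13) := by
  have C := FutakiReflexive.modelCycle a
  exact ⟨C.exists_isVolumeMinimum, fun b V hb =>
    ⟨C.exists_futakiInvariant hb, FutakiReflexive.exists_charge_eq_iff a hb⟩⟩
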